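/- Conventions. Let $H$ be a separable complex Hilbert space and $M\subset B(H)$ a von Neumann algebra (containing $I$), with predual $M_*$, i.e. the space of functionals $X\mapsto \mathrm{Tr}(XK)$ on $M$, $K$ of trace class. A faithful normal trace on $M$ is a weak*-continuous linear functional $\tau$ on $M$ such that $\tau(AB)=\tau(BA)$ for all $A,B\in M$ and, for every positive $A\in M$, $\tau(A)\ge 0$ and $\tau(A)=0$ only if $A=0$. $M$ is called finite if it admits a faithful normal trace. A bounded complex sequence $(u_n)$ is almost convergent to $a$ if $\frac1{n+1}\sum_{i=k}^{k+n}u_i\to a$ as $n\to\infty$, uniformly in $k$; it is strongly almost convergent to $a$ if $(|u_n-a|)$ is almost convergent to $0$. A regular gauge is a map $p:\mathbf N\to(0,\infty)$ for which there is a constant $c_p>0$ such that $p(n+1)/p(n)$ is strongly almost convergent to $c_p$ and $c_p^n/p(n)$ is strongly almost convergent to $1$. A set $\mathcal S\subset M$ is dominated by $p$ if $\|T^n\|\le p(n)$ for all $T\in\mathcal S$ and $n\ge1$. A bounded linear map $\phi:M\to M$ is $M$-stable if it is weak*-continuous and, for every faithful normal trace $\tau$ on $M$ and every $X\in M$, there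 is $Z\in M$ with $\tau(X\phi(Y))=\tau(ZY)$ for all $Y\in M$. A projection on $M$ is an idempotent bounded linear map. Statement. Let $M$ be a finite von Neumann algebra acting on $H$, and let $\mathcal S\subset M$ be a nonempty set of pairwise commuting operators which is dominated by a regular gauge $p$. Then, for every $T\in\mathcal S$, the sequence of maps $X\mapsto p(n)^{-2}T^{*n}XT^n$ converges weakly almost to a weak*-continuous projection $E_T$ on $M$, that is, $l\bigl(p(n)^{-2}T^{*n}XT^n-E_T(X)\bigr)$ is almost convergent to $0$ for all $l\in M_*$ and $X\in M$; and the maps $E_T$ $(T\in\mathcal S)$ commute with each other. Let $\mathcal E(\mathcal S)=\{E_{T_1}\circ\dots\circ E_{T_n}: n\ge1,\ T_1,\dots,T_n\in\mathcal S\}$, viewed as a net indexed by itself with the order $F\le F'$ iff $F'=F''\circ F$ for some $F''\in\mathcal E(\mathcal S)$. This net converges weakly to a completely positive $M$-stable projection $E$ on $M$ (that is, $l(F(X))\to l(E(X))$ along the net for all $l\in M_*$, $X\in M$), and $E$ satisfies: (i) $E(T^*XT)=c_p^2E(X)$ for all $T\in\mathcal S$ and $X\in M$; (ii) $E(A^*XB)=A^*E(X)B$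 for all $X\in M$ and all $A,B\in\mathcal S'$ with $A^*XB\in M$, where $\mathcal S'\subset B(H)$ is the set of operators commuting with every element of $\mathcal S$; in particular, this holds for all $X\in M$ and $A,B\in\mathcal S'\cap M$. -/

import Mathlib

open Filter Topology

namespace FiniteVN

section Sequences

/-- A (bounded) complex sequence `u` is almost convergent to `c`: the averages of `n + 1` consecutive
terms `u k, …, u (k + n)` tend to `c` as `n → ∞`, uniformly in the starting index `k`.
(Neither this notion nor its strong form depends on finitely many terms of the sequence, so it does
not matter whether sequences start at `0` or at `1`.) -/
def AlmostConvergesTo (u : ℕ → ℂ) (c : ℂ) : Prop :=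
  (∃ C : ℝ, ∀ n, ‖u n‖ ≤ C) ∧
    TendstoUniformly
      (fun (n : ℕ) (k : ℕ) => ((n : ℂ) + 1)⁻¹ * ∑ i ∈ Finset.range (n + 1), u (k + i))
      (fun _ => c) atTop

/-- `u` is strongly almost convergent to `c`: the sequence `|u n - c|` almost converges to `0`. -/
def StronglyAlmostConvergesTo (u : ℕ → ℂ) (c : ℂ) : Prop :=
  AlmostConvergesTo (fun n => ((‖u n - c‖ : ℝ) : ℂ)) 0

/-- `p : ℕ → (0, ∞)` is a gauge with constant `c = c_p > 0`. -/
def IsGauge (p : ℕ → ℝ) (c : ℝ) : Prop :=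
  (∀ n, 0 < p n) ∧ 0 < c ∧
    StronglyAlmostConvergesTo (fun n => ((p (n + 1) / p n : ℝ) : ℂ)) (c : ℂ)

/-- `p` is a regular gauge with constant `c = c_p`. -/
def IsRegularGauge (p : ℕ → ℝ) (c : ℝ) : Prop :=
  IsGauge p c ∧ StronglyAlmostConvergesTo (fun n => ((c ^ n / p n : ℝ) : ℂ)) 1

end Sequences

section Algebra

variable {H : Type*} [NormedAddCommGroup H] [InnerProductSpace ℂ H] [CompleteSpace H]

/-- The elements of the von Neumann algebra `M`, as a normed star algebra. -/
abbrev Elt (M : VonNeumannAlgebra H) : Type _ := M.toStarSubalgebra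

/-- `B(M)`: the bounded linear maps of `M` into itself. The product is composition. -/
abbrev BoundedMap (M : VonNeumannAlgebra H) : Type _ := Elt M →L[ℂ] Elt M

variable (M : VonNeumannAlgebra H)

/-- The predual `M_*`, as a set of linear functionals on `M`: the restrictions to `M` of the
functionals given by trace class operators `∑ ⟨·, y n⟩ x n`, that is,
`A ↦ ∑ ⟨A (x n), y n⟩` with `∑ ‖x n‖² < ∞` and `∑ ‖y n‖² < ∞`. -/
def predual : Set (Elt M →ₗ[ℂ] ℂ) :=
  {l | ∃ x y : ℕ → H, (Summable fun n => ‖x n‖ ^ 2) ∧ (Summable fun n => ‖y n‖ ^ 2) ∧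
    ∀ A : Elt M, HasSum (fun n => inner ℂ (y n) ((A : H →L[ℂ] H) (x n))) (l A)}

/-- The ultraweak (weak*) topology of `M`: the coarsest topology making every element of the
predual continuous. -/
@[reducible] noncomputable def ultraweakTopology : TopologicalSpace (Elt M) :=
  ⨅ l ∈ predual M, TopologicalSpace.induced (fun A => l A) inferInstance

variable {M}

/-- Weak*-continuity of a bounded linear map, i.e. membership in `B_w(M)`. -/
def WeakStarContinuous (φ : BoundedMap M) : Prop :=
  Continuous[ultraweakTopology M, ultraweakTopology M] fun A => φ A

/-- `τ` is a faithful normal (finite) trace on `M`. Normality, i.e. ultraweak continuity, says that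
`τ` is an element of the predual. -/
structure IsFaithfulNormalTrace (τ : Elt M →ₗ[ℂ] ℂ) : Prop where
  normal : τ ∈ predual M
  tracial : ∀ A B : Elt M, τ (A * B) = τ (B * A)
  nonneg : ∀ A : Elt M, (A : H →L[ℂ] H).IsPositive → 0 ≤ (τ A).re ∧ (τ A).im = 0
  faithful : ∀ A : Elt M, (A : H →L[ℂ] H).IsPositive → τ A = 0 → A = 0

variable (M) in
/-- `M` is finite: it admits a faithful normal trace. -/
def IsFinite : Prop := ∃ τ : Elt M →ₗ[ℂ] ℂ, IsFaithfulNormalTrace τ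

/-- `φ` is `τ`-`M`-stable: `φ` is weak*-continuous and the preadjoint `φ_* : l ↦ l ∘ φ` maps each
functional `l_X = τ (X ·)`, `X ∈ M`, to a functional `l_Z = τ (Z ·)`, `Z ∈ M`. -/
def IsStableFor (τ : Elt M →ₗ[ℂ] ℂ) (φ : BoundedMap M) : Prop :=
  WeakStarContinuous φ ∧ ∀ X : Elt M, ∃ Z : Elt M, ∀ Y : Elt M, τ (X * φ Y) = τ (Z * Y)

/-- `φ` is `M`-stable: it is `τ`-`M`-stable for every faithful normal trace `τ` on `M`. -/
def IsStable (φ : BoundedMap M) : Prop :=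
  ∀ τ : Elt M →ₗ[ℂ] ℂ, IsFaithfulNormalTrace τ → IsStableFor τ φ

/-- Positivity of the operator matrix `[A i j]`, acting on the orthogonal sum of `n` copies
of `H`: its quadratic form takes real nonnegative values. -/
def MatrixPositive {n : ℕ} (A : Fin n → Fin n → Elt M) : Prop :=
  ∀ x : Fin n → H,
    0 ≤ (∑ i, ∑ j, inner ℂ (x i) ((A i j : H →L[ℂ] H) (x j))).re ∧
    (∑ i, ∑ j, inner ℂ (x i) ((A i j : H →L[ℂ] H) (x j))).im = 0

/-- `φ` is completely positive: `[A i j] ↦ [φ (A i j)]` preserves positivity for matrices of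
every size. -/
def IsCompletelyPositive (φ : BoundedMap M) : Prop :=
  ∀ (n : ℕ) (A : Fin n → Fin n → Elt M), MatrixPositive A → MatrixPositive fun i j => φ (A i j)

/-- The operator `T` is dominated by `p`: `‖T ^ n‖ ≤ p n` for every positive integer `n`. -/
def IsDominatedBy (T : Elt M) (p : ℕ → ℝ) : Prop := ∀ n : ℕ, 1 ≤ n → ‖T ^ n‖ ≤ p n

/-- A sequence in `B(M)` is weakly almost convergent to the weak*-continuous map `ψ`. -/
def WeaklyAlmostConvergesTo (φ : ℕ → BoundedMap M) (ψ : BoundedMap M) : Prop :=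
  WeakStarContinuous ψ ∧
    ∀ l ∈ predual M, ∀ X : Elt M, AlmostConvergesTo (fun n => l (φ n X - ψ X)) 0

/-- The maps `X ↦ p(n)⁻² T*ⁿ X Tⁿ`. -/
noncomputable def conjSeq (p : ℕ → ℝ) (T : Elt M) (n : ℕ) : BoundedMap M :=
  (((p n ^ 2)⁻¹ : ℝ) : ℂ) • ContinuousLinearMap.mulLeftRight ℂ (Elt M) (star T ^ n) (T ^ n)

/-- The order of a semigroup `𝓔` of maps: `F ≤ F'` iff `F' = F'' ∘ F` for some `F'' ∈ 𝓔`. -/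
def NetLE (𝓔 : Subsemigroup (BoundedMap M)) (F F' : BoundedMap M) : Prop :=
  ∃ F'' ∈ 𝓔, F' = F'' * F

/-- The semigroup `𝓔`, as a net indexed by itself with the order `NetLE`, converges weakly to `E`:
`l (F X) → l (E X)` along the net, for all `l ∈ M_*` and `X ∈ M`. -/
def NetConvergesWeaklyTo (𝓔 : Subsemigroup (BoundedMap M)) (E : BoundedMap M) : Prop :=
  ∀ l ∈ predual M, ∀ X : Elt M, ∀ ε : ℝ, 0 < ε →
    ∃ F₀ ∈ 𝓔, ∀ F ∈ 𝓔, NetLE 𝓔 F₀ F → ‖l (F X) - l (E X)‖ < ε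

end Algebra

end FiniteVN

/-! The proof is a mean ergodic argument in `L²(M, τ)`, transported to `M` by ultraweak compactness
of balls. For `T ∈ S` write `α_n(X) = p(n)⁻² T*ⁿ X Tⁿ`, `Θ(X) = c⁻² T* X T` and `w_n = (cⁿ/p(n))²`.
For `n ≥ 1` the `α_n` contract both the operator norm and the `L²` norm, whereas `Θ` need not. What
replaces contractivity of `Θ` is the identity `α_n Θ = (w_n / w_{n+1}) α_{n+1}`. Since the ratios
average to `1`, long averages of `α_n` nearly kill every coboundary `X - ΘX`
(`averageMap_coboundary`). Since the weights average to `1`, these averages nearly fix every fixed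
point of `Θ` (`averageMap_of_weights`). Both estimates are uniform in the position of the window.

Let `E_T` be an ultraweak limit of averages along an ultrafilter. Then `E_T Θ = Θ E_T = E_T`, so
`E_T` is idempotent. A vector orthogonal to all coboundaries defines a `Θ`-invariant functional,
which takes equal values at `X` and `E_T X`. Hence `X - E_T X` is an `L²` limit of coboundaries, and
the averages converge in `L²` uniformly in the window (`IsErgodicLimit.uniform_toL2`). On balls of
`M` a normal functional is controlled by the `L²` norm (`exists_delta_of_normal`), which gives weak
almost convergence.

An `L²`-contractive idempotent is an orthogonal projection, so `‖F X‖₂` decreases along the net and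
Pythagoras makes the net Cauchy (`exists_small_tail`). The limit absorbs every `E_T`, whence (i).
Complete positivity, the bimodule identity and stability hold for each `α_n`, `n ≥ 1`, and survive
products, averages and limits (`IsAdmissible`). For stability the point is that the element
representing the preadjoint of `τ(X ·)` has norm at most `‖X‖`, so compactness supplies one for the
limit. -/

namespace FiniteVN

/-! ### Normal functionals as a Banach space, and `M` as its dual. -/

section Duality

variable {H : Type*} [NormedAddCommGroup H] [InnerProductSpace ℂ H] [CompleteSpace H]
variable (M : VonNeumannAlgebra H)

/-- The vector functional `A ↦ ⟪u, A v⟫` on `M`. -/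
noncomputable def vecFunctional (u v : H) : StrongDual ℂ (Elt M) :=
  LinearMap.mkContinuous
    { toFun := fun A => inner ℂ u ((A : H →L[ℂ] H) v)
      map_add' := fun A B => by simp
      map_smul' := fun a A => by simp }
    (‖u‖ * ‖v‖) fun A => by
      refine (norm_inner_le_norm _ _).trans ?_
      have h : ‖(A : H →L[ℂ] H) v‖ ≤ ‖A‖ * ‖v‖ := (A : H →L[ℂ] H).le_opNorm v
      calc ‖u‖ * ‖(A : H →L[ℂ] H) v‖ ≤ ‖u‖ * (‖A‖ * ‖v‖) := by gcongr
        _ = ‖u‖ * ‖v‖ * ‖A‖ := by ring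

@[simp] theorem vecFunctional_apply (u v : H) (A : Elt M) :
    vecFunctional M u v A = inner ℂ u ((A : H →L[ℂ] H) v) := rfl

theorem norm_vecFunctional_le (u v : H) : ‖vecFunctional M u v‖ ≤ ‖u‖ * ‖v‖ :=
  LinearMap.mkContinuous_norm_le _ (by positivity) _

/-- The normal functionals on `M`: the closed linear span of the vector functionals. -/
noncomputable def normalFunctionals : Submodule ℂ (StrongDual ℂ (Elt M)) :=
  (Submodule.span ℂ (Set.range fun w : H × H => vecFunctional M w.1 w.2)).topologicalClosure

theorem isClosed_normalFunctionals : IsClosed (normalFunctionals M : Set (StrongDual ℂ (Elt M))) :=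
  Submodule.isClosed_topologicalClosure _

theorem vecFunctional_mem (u v : H) : vecFunctional M u v ∈ normalFunctionals M :=
  Submodule.le_topologicalClosure _ (Submodule.subset_span ⟨(u, v), rfl⟩)

variable {M}

theorem normalFunctionals_le {V : Submodule ℂ (StrongDual ℂ (Elt M))}
    (hV : IsClosed (V : Set (StrongDual ℂ (Elt M)))) (h : ∀ u v, vecFunctional M u v ∈ V) :
    normalFunctionals M ≤ V :=
  Submodule.topologicalClosure_minimal _
    (Submodule.span_le.2 (by rintro _ ⟨w, rfl⟩; exact h _ _)) hV

theorem ext_inner_elt {X Y : Elt M}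
    (h : ∀ u v : H, inner ℂ u ((X : H →L[ℂ] H) v) = inner ℂ u ((Y : H →L[ℂ] H) v)) : X = Y := by
  apply Subtype.ext
  ext v
  exact ext_inner_left ℂ fun u => h u v

theorem ext_normal {X Y : Elt M} (h : ∀ l ∈ normalFunctionals M, l X = l Y) : X = Y :=
  ext_inner_elt fun u v => h _ (vecFunctional_mem M u v)

/-- Normality of `l ∘ φ` is a closed linear condition on `l`, so vector functionals suffice. -/
theorem comp_normal_of_vecFunctional {φ : BoundedMap M}
    (h : ∀ u v, (vecFunctional M u v).comp φ ∈ normalFunctionals M)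
    {l : StrongDual ℂ (Elt M)} (hl : l ∈ normalFunctionals M) : l.comp φ ∈ normalFunctionals M :=
  normalFunctionals_le (V := (normalFunctionals M).comap
      ((ContinuousLinearMap.compL ℂ (Elt M) (Elt M) ℂ).flip φ).toLinearMap)
    (IsClosed.preimage (f := (ContinuousLinearMap.compL ℂ (Elt M) (Elt M) ℂ).flip φ)
      (ContinuousLinearMap.continuous _) (isClosed_normalFunctionals M)) h hl

theorem comp_mulLeftRight_mem (A B : Elt M) {l : StrongDual ℂ (Elt M)}
    (hl : l ∈ normalFunctionals M) :
    l.comp (ContinuousLinearMap.mulLeftRight ℂ (Elt M) A B) ∈ normalFunctionals M := by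
  refine comp_normal_of_vecFunctional (fun u v => ?_) hl
  have : (vecFunctional M u v).comp (ContinuousLinearMap.mulLeftRight ℂ (Elt M) A B) =
      vecFunctional M (star (A : H →L[ℂ] H) u) ((B : H →L[ℂ] H) v) := by
    ext X
    simp [ContinuousLinearMap.star_eq_adjoint, ContinuousLinearMap.adjoint_inner_left]
  rw [this]
  exact vecFunctional_mem M _ _

/-- A bounded sesquilinear form that is balanced over the commutant of `M` is given by an
element of `M`. -/
theorem exists_elt_of_form (B : H → H → ℂ) (C : ℝ)
    (add_left : ∀ u u' v, B (u + u') v = B u v + B u' v)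
    (smul_left : ∀ (a : ℂ) u v, B (a • u) v = star a * B u v)
    (add_right : ∀ u v v', B u (v + v') = B u v + B u v')
    (smul_right : ∀ (a : ℂ) u v, B u (a • v) = a * B u v)
    (bound : ∀ u v, ‖B u v‖ ≤ C * ‖u‖ * ‖v‖)
    (balanced : ∀ A ∈ M.commutant, ∀ u v, B (star A u) v = B u (A v)) (hC : 0 ≤ C) :
    ∃ X : Elt M, ‖X‖ ≤ C ∧ ∀ u v, inner ℂ u ((X : H →L[ℂ] H) v) = B u v := by
  let b : H →L⋆[ℂ] H →L[ℂ] ℂ := LinearMap.mkContinuous₂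
    (LinearMap.mk₂'ₛₗ (starRingEnd ℂ) (RingHom.id ℂ) B add_left smul_left add_right smul_right)
    C bound
  let Y : H →L[ℂ] H := ContinuousLinearMap.adjoint (InnerProductSpace.continuousLinearMapOfBilin b)
  have hY : ∀ u v, inner ℂ u (Y v) = B u v := fun u v => by
    rw [ContinuousLinearMap.adjoint_inner_right,
      InnerProductSpace.continuousLinearMapOfBilin_apply]
    rfl
  have hYM : Y ∈ M := by
    rw [← VonNeumannAlgebra.commutant_commutant M, VonNeumannAlgebra.mem_commutant_iff]
    intro A hA
    ext v
    refine ext_inner_left ℂ fun u => ?_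
    simp only [mul_apply_eq_comp]
    rw [hY, ← balanced A hA, ← hY, ContinuousLinearMap.star_eq_adjoint,
      ContinuousLinearMap.adjoint_inner_left]
  refine ⟨⟨Y, hYM⟩, ?_, hY⟩
  refine ContinuousLinearMap.opNorm_le_bound _ hC fun v => ?_
  rcases eq_or_ne (Y v) 0 with h0 | h0
  · change ‖Y v‖ ≤ _
    rw [h0, norm_zero]
    positivity
  · have h1 : ‖Y v‖ * ‖Y v‖ ≤ ‖Y v‖ * (C * ‖v‖) := by
      calc ‖Y v‖ * ‖Y v‖ = ‖(inner ℂ (Y v) (Y v) : ℂ)‖ := by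
            rw [inner_self_eq_norm_sq_to_K, norm_pow, RCLike.norm_ofReal, abs_norm, sq]
        _ ≤ _ := by rw [hY]; exact (bound _ _).trans_eq (by ring)
    exact le_of_mul_le_mul_left h1 (norm_pos_iff.2 h0)

theorem exists_tendsto_of_bounded {ι : Type*} (U : Ultrafilter ι) (g : ι → ℂ) (C : ℝ)
    (hg : ∀ᶠ i in (U : Filter ι), ‖g i‖ ≤ C) : ∃ z, ‖z‖ ≤ C ∧ Tendsto g U (𝓝 z) := by
  obtain ⟨z, hz, h⟩ := (isCompact_closedBall (0 : ℂ) C).ultrafilter_le_nhds (U.map g)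
    (by
      rw [le_principal_iff, Ultrafilter.coe_map, mem_map]
      filter_upwards [hg] with i hi
      simpa using hi)
  exact ⟨z, by simpa using hz, h⟩

/-- Pointwise convergence of functionals on a bounded family passes to norm limits. -/
theorem tendsto_of_mem_normal {ι : Type*} {F : Filter ι} {f : ι → Elt M} {X : Elt M} {C : ℝ}
    (hf : ∀ᶠ i in F, ‖f i‖ ≤ C)
    (h : ∀ u v, Tendsto (fun i => (inner ℂ u ((f i : H →L[ℂ] H) v) : ℂ)) F
      (𝓝 (inner ℂ u ((X : H →L[ℂ] H) v))))
    {l : StrongDual ℂ (Elt M)} (hl : l ∈ normalFunctionals M) :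
    Tendsto (fun i => l (f i)) F (𝓝 (l X)) := by
  let V : Submodule ℂ (StrongDual ℂ (Elt M)) :=
    { carrier := {l | Tendsto (fun i => l (f i)) F (𝓝 (l X))}
      add_mem' := fun {a b} ha hb => by simpa using Tendsto.add ha hb
      zero_mem' := by simpa using tendsto_const_nhds
      smul_mem' := fun a l hl => by simpa using Tendsto.const_mul a hl }
  refine normalFunctionals_le (V := V) ?_ h hl
  rw [← isSeqClosed_iff_isClosed]
  intro ls l hls hl
  simp only [V, Submodule.coe_set_mk, AddSubmonoid.coe_set_mk, AddSubsemigroup.coe_set_mk,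
    Set.mem_ofPred_eq] at hls ⊢
  rw [Metric.tendsto_nhds]
  intro ε hε
  -- `|C| + ‖X‖` bounds `‖f i - X‖`; the absolute value and the `1` keep the denominator positive
  -- with no sign assumption on `C`.
  have hK : 0 < |C| + ‖X‖ + 1 := by positivity
  obtain ⟨n, hn⟩ := ((Metric.tendsto_nhds.1 hl) (ε / (2 * (|C| + ‖X‖ + 1))) (by positivity)).exists
  rw [dist_eq_norm] at hn
  filter_upwards [hf, (Metric.tendsto_nhds.1 (hls n)) (ε / 2) (by positivity)] with i hi h2
  rw [dist_eq_norm] at h2 ⊢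
  have e : l (f i) - l X = (ls n (f i) - ls n X) - (ls n - l) (f i - X) := by
    simp only [map_sub, sub_apply]; ring
  have h3 : ‖(ls n - l) (f i - X)‖ ≤ ‖ls n - l‖ * (|C| + ‖X‖ + 1) := by
    refine ((ls n - l).le_opNorm _).trans ?_
    gcongr
    have := norm_sub_le (f i) X
    have := le_abs_self C
    linarith
  have h4 : ‖ls n - l‖ * (|C| + ‖X‖ + 1) < ε / 2 := by
    have := (lt_div_iff₀ (by positivity)).1 hn
    linarith
  rw [e]
  have := norm_sub_le (ls n (f i) - ls n X) ((ls n - l) (f i - X))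
  linarith

/-- Balls of `M` are ultraweakly compact. -/
theorem exists_ultraweak_limit {ι : Type*} (U : Ultrafilter ι) (f : ι → Elt M) (C : ℝ)
    (hC : 0 ≤ C) (hf : ∀ᶠ i in (U : Filter ι), ‖f i‖ ≤ C) :
    ∃ X : Elt M, ‖X‖ ≤ C ∧ ∀ l ∈ normalFunctionals M, Tendsto (fun i => l (f i)) U (𝓝 (l X)) := by
  have key : ∀ u v, ∃ z : ℂ, ‖z‖ ≤ C * ‖u‖ * ‖v‖ ∧
      Tendsto (fun i => (inner ℂ u ((f i : H →L[ℂ] H) v) : ℂ)) U (𝓝 z) := fun u v => by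
    refine exists_tendsto_of_bounded U _ _ ?_
    filter_upwards [hf] with i hi
    refine (norm_inner_le_norm _ _).trans ?_
    have h1 : ‖(f i : H →L[ℂ] H) v‖ ≤ ‖f i‖ * ‖v‖ := (f i : H →L[ℂ] H).le_opNorm v
    calc ‖u‖ * ‖(f i : H →L[ℂ] H) v‖ ≤ ‖u‖ * (C * ‖v‖) := by gcongr; exact h1.trans (by gcongr)
      _ = _ := by ring
  choose B hB hlim using key
  -- The limits of the matrix coefficients form a sesquilinear form. It is balanced over the
  -- commutant because each `f i` commutes with it.
  obtain ⟨X, hX, hXB⟩ := exists_elt_of_form (M := M) B C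
    (fun u u' v => tendsto_nhds_unique (hlim _ _)
      (((hlim u v).add (hlim u' v)).congr fun i => by rw [inner_add_left]))
    (fun a u v => tendsto_nhds_unique (hlim _ _)
      (((hlim u v).const_mul (star a)).congr fun i => by rw [inner_smul_left]; rfl))
    (fun u v v' => tendsto_nhds_unique (hlim _ _)
      (((hlim u v).add (hlim u v')).congr fun i => by rw [map_add, inner_add_right]))
    (fun a u v => tendsto_nhds_unique (hlim _ _)
      (((hlim u v).const_mul a).congr fun i => by rw [map_smul, inner_smul_right]))
    hB
    (fun A hA u v => tendsto_nhds_unique (hlim _ _)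
      ((hlim u (A v)).congr fun i => by
        rw [ContinuousLinearMap.star_eq_adjoint, ContinuousLinearMap.adjoint_inner_left,
          ← mul_apply_eq_comp, ← mul_apply_eq_comp,
          VonNeumannAlgebra.mem_commutant_iff.1 hA (f i) (f i).2])) hC
  exact ⟨X, hX, fun l hl => tendsto_of_mem_normal hf
    (fun u v => by rw [hXB]; exact hlim u v) hl⟩

/-- A bounded family of maps has a pointwise ultraweak limit along every ultrafilter. -/
theorem exists_map_limit {ι : Type*} (U : Ultrafilter ι) (φ : ι → BoundedMap M)
    (hφ : ∀ i, ‖φ i‖ ≤ 1) :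
    ∃ ψ : BoundedMap M, ‖ψ‖ ≤ 1 ∧ ∀ l ∈ normalFunctionals M, ∀ X,
      Tendsto (fun i => l (φ i X)) U (𝓝 (l (ψ X))) := by
  have key : ∀ X : Elt M, ∃ Y : Elt M, ‖Y‖ ≤ ‖X‖ ∧
      ∀ l ∈ normalFunctionals M, Tendsto (fun i => l (φ i X)) U (𝓝 (l Y)) := fun X =>
    exists_ultraweak_limit U _ _ (norm_nonneg _) (Eventually.of_forall fun i =>
      ((φ i).le_of_opNorm_le (hφ i) X).trans_eq (one_mul _))
  choose ψ hψ hlim using key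
  refine ⟨LinearMap.mkContinuous
    { toFun := ψ
      map_add' := fun X Y => ext_normal fun l hl => ?_
      map_smul' := fun a X => ext_normal fun l hl => ?_ } 1
      (fun X => (hψ X).trans_eq (one_mul _).symm),
    LinearMap.mkContinuous_norm_le _ zero_le_one _, fun l hl X => hlim X l hl⟩
  · exact tendsto_nhds_unique (hlim _ l hl)
      (by simpa using (hlim X l hl).add (hlim Y l hl))
  · exact tendsto_nhds_unique (hlim _ l hl)
      (by simpa using (hlim X l hl).const_mul a)

/-- `M` is the dual of the space of normal functionals. -/
theorem exists_elt_of_bidual (F : StrongDual ℂ (StrongDual ℂ (Elt M))) :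
    ∃ X : Elt M, ∀ l ∈ normalFunctionals M, F l = l X := by
  obtain ⟨X, -, hX⟩ := exists_elt_of_form (M := M) (fun u v => F (vecFunctional M u v)) ‖F‖
    (fun u u' v => by
      rw [← map_add]; congr 1; ext A; simp)
    (fun a u v => by
      rw [← smul_eq_mul, ← map_smul]; congr 1; ext A; simp [mul_comm])
    (fun u v v' => by
      rw [← map_add]; congr 1; ext A; simp)
    (fun a u v => by
      rw [← smul_eq_mul, ← map_smul]; congr 1; ext A; simp)
    (fun u v => by
      refine (F.le_opNorm _).trans ?_
      rw [mul_assoc]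
      gcongr
      exact norm_vecFunctional_le M u v)
    (fun A hA u v => by
      congr 1; ext X
      rw [vecFunctional_apply, vecFunctional_apply, ContinuousLinearMap.star_eq_adjoint,
        ContinuousLinearMap.adjoint_inner_left,
        ← mul_apply_eq_comp, ← mul_apply_eq_comp,
        VonNeumannAlgebra.mem_commutant_iff.1 hA X X.2]) (ContinuousLinearMap.opNorm_nonneg F)
  refine ⟨X, fun l hl => ?_⟩
  have := normalFunctionals_le (V := LinearMap.eqLocus F.toLinearMap
    (NormedSpace.inclusionInDoubleDual ℂ (Elt M) X).toLinearMap)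
    (isClosed_eq F.continuous (NormedSpace.inclusionInDoubleDual ℂ (Elt M) X).continuous)
    (fun u v => (hX u v).symm) hl
  exact this

end Duality

/-! ### Absolutely summable coefficients on pairs of vectors. -/

section Coefficients

/-- Absolutely summable coefficient families on pairs of vectors. -/
abbrev CoeffSpace (H : Type*) : Type _ := lp (fun _ : H × H => ℂ) 1

theorem CoeffSpace.summable_norm {H : Type*} (a : CoeffSpace H) : Summable fun i => ‖a i‖ := by
  simpa using (memℓp_gen_iff (by simp)).1 (lp.memℓp a)

theorem CoeffSpace.norm_eq {H : Type*} (a : CoeffSpace H) : ‖a‖ = ∑' i, ‖a i‖ := by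
  simpa using lp.norm_eq_tsum_rpow (p := 1) (by simp) a

variable {H : Type*} [NormedAddCommGroup H]

open Classical in
/-- A family of coefficients representing the vector functional of `u` and `v`. -/
noncomputable def vecCoeff (u v : H) : CoeffSpace H :=
  lp.single 1 (u, v) ((‖u‖ * ‖v‖ : ℝ) : ℂ)

theorem norm_vecCoeff (u v : H) : ‖vecCoeff u v‖ = ‖u‖ * ‖v‖ := by
  classical
  rw [vecCoeff, lp.norm_single zero_lt_one, Complex.norm_real, Real.norm_of_nonneg (by positivity)]

variable [InnerProductSpace ℂ H]

/-- The vector `v / ‖v‖`. -/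
noncomputable def unitVec (v : H) : H := ((‖v‖⁻¹ : ℝ) : ℂ) • v

theorem norm_unitVec_le (v : H) : ‖unitVec v‖ ≤ 1 := by
  rw [unitVec, norm_smul, Complex.norm_real, norm_inv, norm_norm]
  exact inv_mul_le_one

theorem norm_smul_unitVec (v : H) : (‖v‖ : ℂ) • unitVec v = v := by
  rcases eq_or_ne v 0 with rfl | h
  · simp [unitVec]
  · rw [unitVec, smul_smul, ← Complex.ofReal_mul, mul_inv_cancel₀ (norm_ne_zero_iff.2 h),
      Complex.ofReal_one, one_smul]

end Coefficients

/-! ### Norm limits of vector functionals are trace class functionals. -/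

section Predual

variable {H : Type*} [NormedAddCommGroup H] [InnerProductSpace ℂ H] [CompleteSpace H]
variable (M : VonNeumannAlgebra H)

theorem norm_vecFunctional_unitVec_le (w : H × H) :
    ‖vecFunctional M (unitVec w.1) (unitVec w.2)‖ ≤ 1 :=
  (norm_vecFunctional_le M _ _).trans
    (mul_le_one₀ (norm_unitVec_le _) (norm_nonneg _) (norm_unitVec_le _))

theorem CoeffSpace.summable_smul (a : CoeffSpace H) :
    Summable fun i => a i • vecFunctional M (unitVec i.1) (unitVec i.2) := by
  refine Summable.of_norm_bounded (CoeffSpace.summable_norm a) fun i => ?_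
  rw [norm_smul]
  exact mul_le_of_le_one_right (norm_nonneg _) (norm_vecFunctional_unitVec_le M i)

/-- The normal functional with a given family of coefficients. -/
noncomputable def ofCoeff : CoeffSpace H →L[ℂ] StrongDual ℂ (Elt M) :=
  LinearMap.mkContinuous
    { toFun := fun a => ∑' i, a i • vecFunctional M (unitVec i.1) (unitVec i.2)
      map_add' := fun a b => by
        rw [← (CoeffSpace.summable_smul M a).tsum_add (CoeffSpace.summable_smul M b)]
        exact tsum_congr fun i => by
          rw [lp.coeFn_add, Pi.add_apply]
          exact add_smul (a i) (b i) (vecFunctional M (unitVec i.1) (unitVec i.2))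
      map_smul' := fun c a => by
        simp only [RingHom.id_apply]
        rw [← (CoeffSpace.summable_smul M a).tsum_const_smul]
        exact tsum_congr fun i => mul_smul _ _ _ } 1 fun a => by
      rw [one_mul, CoeffSpace.norm_eq]
      refine tsum_of_norm_bounded (CoeffSpace.summable_norm a).hasSum fun i => ?_
      rw [norm_smul]
      exact mul_le_of_le_one_right (norm_nonneg _) (norm_vecFunctional_unitVec_le M i)

theorem hasSum_ofCoeff (a : CoeffSpace H) :
    HasSum (fun i => a i • vecFunctional M (unitVec i.1) (unitVec i.2)) (ofCoeff M a) :=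
  (CoeffSpace.summable_smul M a).hasSum

open Classical in
theorem ofCoeff_single (i : H × H) (c : ℂ) :
    ofCoeff M (lp.single 1 i c) = c • vecFunctional M (unitVec i.1) (unitVec i.2) := by
  refine (hasSum_ofCoeff M _).unique ?_
  convert hasSum_single i ?_ using 1
  · simp
  · intro j hj
    rw [lp.single_apply_ne _ _ _ hj]
    exact zero_smul ℂ (vecFunctional M (unitVec j.1) (unitVec j.2))

theorem ofCoeff_vecCoeff (u v : H) : ofCoeff M (vecCoeff u v) = vecFunctional M u v := by
  rw [vecCoeff, ofCoeff_single]
  ext A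
  conv_rhs => rw [← norm_smul_unitVec u, ← norm_smul_unitVec v]
  rw [smul_apply, vecFunctional_apply, vecFunctional_apply, map_smul,
    inner_smul_left, inner_smul_right, Complex.conj_ofReal]
  push_cast
  rw [smul_eq_mul]
  ring

/-- A functional on coefficients that vanishes on the relations is evaluation at an element
of `M`. -/
theorem exists_elt_of_ofCoeff_dual (G : StrongDual ℂ (CoeffSpace H)) (hG : ‖G‖ ≤ 1)
    (hker : ∀ a b, ofCoeff M a = ofCoeff M b → G a = G b) :
    ∃ X : Elt M, ‖X‖ ≤ 1 ∧ ∀ a, G a = ofCoeff M a X := by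
  classical
  -- `vecCoeff` is not sesquilinear; only its image under `ofCoeff` is. Each identity for the form
  -- therefore goes through `hker`.
  obtain ⟨X, hX, hGX⟩ := exists_elt_of_form (M := M) (fun u v => G (vecCoeff u v)) 1
    (fun u u' v => by
      rw [← map_add]; refine hker _ _ ?_
      rw [map_add]; simp only [ofCoeff_vecCoeff]; ext A; simp)
    (fun a u v => by
      rw [← smul_eq_mul, ← map_smul]; refine hker _ _ ?_
      rw [map_smul]; simp only [ofCoeff_vecCoeff]; ext A; simp [mul_comm])
    (fun u v v' => by
      rw [← map_add]; refine hker _ _ ?_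
      rw [map_add]; simp only [ofCoeff_vecCoeff]; ext A; simp)
    (fun a u v => by
      rw [← smul_eq_mul, ← map_smul]; refine hker _ _ ?_
      rw [map_smul]; simp only [ofCoeff_vecCoeff]; ext A; simp)
    (fun u v => by
      refine (G.le_of_opNorm_le hG _).trans ?_
      rw [norm_vecCoeff, mul_assoc])
    (fun A hA u v => by
      refine hker _ _ ?_
      simp only [ofCoeff_vecCoeff]; ext X
      rw [vecFunctional_apply, vecFunctional_apply, ContinuousLinearMap.star_eq_adjoint,
        ContinuousLinearMap.adjoint_inner_left,
        ← mul_apply_eq_comp, ← mul_apply_eq_comp,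
        VonNeumannAlgebra.mem_commutant_iff.1 hA X X.2]) zero_le_one
  refine ⟨X, hX, fun a => ?_⟩
  have h1 := (lp.hasSum_single (p := 1) ENNReal.one_ne_top a).mapL G
  have h2 := ((lp.hasSum_single (p := 1) ENNReal.one_ne_top a).mapL (ofCoeff M)).mapL
    (NormedSpace.inclusionInDoubleDual ℂ (Elt M) X)
  refine h1.unique (h2.congr_fun fun i => ?_)
  rw [NormedSpace.dual_def, ofCoeff_single, smul_apply, vecFunctional_apply, hGX,
    ← map_smul]
  refine hker _ _ ?_
  rw [map_smul, ofCoeff_vecCoeff, ofCoeff_single]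

/-- The induced map on the quotient by the kernel does not shrink norms. By Hahn–Banach a class has
a norming functional; it is evaluation at some `X` in the unit ball of `M`, so the norm of the class
is at most that of its image. The quotient is complete, so the range is closed. -/
theorem isClosed_range_ofCoeff : IsClosed (Set.range (ofCoeff M)) := by
  let N : Submodule ℂ (CoeffSpace H) := (ofCoeff M).ker
  have : IsClosed (N : Set (CoeffSpace H)) := (ofCoeff M).isClosed_ker
  let Q : (CoeffSpace H ⧸ N) →L[ℂ] StrongDual ℂ (Elt M) := N.liftQL (ofCoeff M) le_rfl
  have hQ : ∀ a, Q (N.mkQ a) = ofCoeff M a := fun a => by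
    simp only [Q, Submodule.liftQL_apply, Submodule.mkQ_apply, Submodule.liftQ_apply]
    rfl
  have bound : ∀ x, ‖x‖ ≤ ‖Q x‖ := fun x => by
    obtain ⟨a, rfl⟩ := N.mkQ_surjective x
    obtain ⟨g, hg, hga⟩ := exists_dual_vector'' ℂ (N.mkQ a)
    let G : StrongDual ℂ (CoeffSpace H) := LinearMap.mkContinuous
      (g.toLinearMap ∘ₗ N.mkQ) 1 fun b => by
        refine (g.le_opNorm _).trans ?_
        gcongr
        exact Submodule.Quotient.norm_mk_le _ b
    obtain ⟨X, hX, hGX⟩ := exists_elt_of_ofCoeff_dual M G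
      (LinearMap.mkContinuous_norm_le _ zero_le_one _) (fun b d h => by
        change g (N.mkQ b) = g (N.mkQ d)
        congr 1
        rw [Submodule.mkQ_apply, Submodule.mkQ_apply, Submodule.Quotient.eq]
        exact LinearMap.mem_ker.2 (by rw [map_sub]; exact sub_eq_zero.2 h))
    have h1 : g (N.mkQ a) = ofCoeff M a X := hGX a
    rw [hga] at h1
    calc ‖N.mkQ a‖ = ‖((‖N.mkQ a‖ : ℝ) : ℂ)‖ := by rw [Complex.norm_real, norm_norm]
      _ = ‖ofCoeff M a X‖ := by rw [← h1]; rfl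
      _ ≤ ‖ofCoeff M a‖ * 1 := (ofCoeff M a).le_opNorm_of_le hX
      _ = ‖Q (N.mkQ a)‖ := by rw [hQ, mul_one]
  have hr : Set.range (ofCoeff M) = Set.range Q := by
    ext l
    constructor
    · rintro ⟨a, rfl⟩; exact ⟨_, hQ a⟩
    · rintro ⟨x, rfl⟩
      obtain ⟨a, rfl⟩ := N.mkQ_surjective x
      exact ⟨a, (hQ a).symm⟩
  rw [hr]
  have anti : AntilipschitzWith 1 Q := by
    refine AddMonoidHomClass.antilipschitz_of_bound Q fun x => ?_
    simpa using bound x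
  exact anti.isClosed_range Q.uniformContinuous

theorem normalFunctionals_le_range : normalFunctionals M ≤ (ofCoeff M).range :=
  normalFunctionals_le (isClosed_range_ofCoeff M)
    fun u v => ⟨vecCoeff u v, ofCoeff_vecCoeff M u v⟩

variable {M}

/-- A functional represented by square summable families over any index set is in the predual. -/
theorem mem_predual_of_hasSum {ι : Type*} (x y : ι → H) (hx : Summable fun i => ‖x i‖ ^ 2)
    (hy : Summable fun i => ‖y i‖ ^ 2) {l : Elt M →ₗ[ℂ] ℂ}
    (h : ∀ A : Elt M, HasSum (fun i => inner ℂ (y i) ((A : H →L[ℂ] H) (x i))) (l A)) :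
    l ∈ predual M := by
  -- Only countably many `x i` are nonzero, so the family can be reindexed by naturals and extended
  -- by zero; the `y i` outside this support contribute nothing.
  have hc : (Function.support fun i => ‖x i‖ ^ 2).Countable := hx.countable_support
  let s := Function.support fun i => ‖x i‖ ^ 2
  have : Countable s := hc
  obtain ⟨e, he⟩ := exists_injective_nat s
  have hext : ∀ (z : ι → H), (Summable fun i => ‖z i‖ ^ 2) →
      Summable fun n => ‖Function.extend e (fun i : s => z i) 0 n‖ ^ 2 := fun z hz => by
    have := (summable_extend_zero he (f := fun i : s => ‖z i‖ ^ 2)).2 (hz.subtype s)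
    refine this.congr fun n => ?_
    by_cases hn : ∃ i, e i = n
    · obtain ⟨i, rfl⟩ := hn
      simp [he.extend_apply]
    · simp [Function.extend_apply' _ _ _ hn]
  refine ⟨_, _, hext x hx, hext y hy, fun A => ?_⟩
  have h1 : HasSum (fun i : s => (inner ℂ (y i) ((A : H →L[ℂ] H) (x i)) : ℂ)) (l A) := by
    refine (hasSum_subtype_iff_of_support_subset (f := fun i =>
      (inner ℂ (y i) ((A : H →L[ℂ] H) (x i)) : ℂ)) fun i hi => ?_).2 (h A)
    intro h0
    apply hi
    have : x i = 0 := by simpa using h0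
    simp [this]
  have h2 := (hasSum_extend_zero he).2 h1
  refine h2.congr_fun fun n => ?_
  by_cases hn : ∃ i, e i = n
  · obtain ⟨i, rfl⟩ := hn
    simp [he.extend_apply]
  · simp [Function.extend_apply' _ _ _ hn]

/-- Splitting each coefficient as `√|a| · (a / √|a|)` turns an absolutely summable family into two
square summable ones; at `a = 0` the convention `0 / 0 = 0` is harmless. -/
theorem ofCoeff_mem_predual (a : CoeffSpace H) :
    ((ofCoeff M a : StrongDual ℂ (Elt M)) : Elt M →ₗ[ℂ] ℂ) ∈ predual M := by
  have hs := CoeffSpace.summable_norm a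
  refine mem_predual_of_hasSum (fun i => ((√‖a i‖ : ℝ) : ℂ) • unitVec i.2)
    (fun i => star (a i / ((√‖a i‖ : ℝ) : ℂ)) • unitVec i.1)
    (Summable.of_nonneg_of_le (fun i => by positivity) (fun i => ?_) hs)
    (Summable.of_nonneg_of_le (fun i => by positivity) (fun i => ?_) hs) fun A => ?_
  · rw [norm_smul, mul_pow, Complex.norm_real, Real.norm_of_nonneg (Real.sqrt_nonneg _),
      Real.sq_sqrt (norm_nonneg _)]
    exact mul_le_of_le_one_right (norm_nonneg _)
      (pow_le_one₀ (norm_nonneg _) (norm_unitVec_le _))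
  · rw [norm_smul, mul_pow, norm_star, norm_div, Complex.norm_real,
      Real.norm_of_nonneg (Real.sqrt_nonneg _), div_pow, Real.sq_sqrt (norm_nonneg _), sq ‖a i‖,
      mul_self_div_self]
    exact mul_le_of_le_one_right (norm_nonneg _)
      (pow_le_one₀ (norm_nonneg _) (norm_unitVec_le _))
  · have h := (hasSum_ofCoeff M a).mapL (NormedSpace.inclusionInDoubleDual ℂ (Elt M) A)
    refine h.congr_fun fun i => ?_
    rw [NormedSpace.dual_def, smul_apply, vecFunctional_apply, inner_smul_left, map_smul,
      inner_smul_right, smul_eq_mul, ← mul_assoc]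
    congr 1
    simp only [RCLike.star_def, RingHomCompTriple.comp_apply, RingHom.id_apply]
    rcases eq_or_ne (a i) 0 with h0 | h0
    · simp [h0]
    · have : ((√‖a i‖ : ℝ) : ℂ) ≠ 0 := by
        rw [Complex.ofReal_ne_zero]
        exact (Real.sqrt_pos.2 (norm_pos_iff.2 h0)).ne'
      exact div_mul_cancel₀ _ this

theorem mem_predual_of_mem_normal {l : StrongDual ℂ (Elt M)} (hl : l ∈ normalFunctionals M) :
    (l : Elt M →ₗ[ℂ] ℂ) ∈ predual M := by
  obtain ⟨a, rfl⟩ := normalFunctionals_le_range M hl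
  exact ofCoeff_mem_predual a

theorem exists_normal_of_mem_predual {l : Elt M →ₗ[ℂ] ℂ} (hl : l ∈ predual M) :
    ∃ f ∈ normalFunctionals M, ∀ A, f A = l A := by
  obtain ⟨x, y, hx, hy, h⟩ := hl
  have hs : Summable fun n => ‖y n‖ * ‖x n‖ := by
    refine Summable.of_nonneg_of_le (fun n => by positivity) (fun n => ?_) (hx.add hy)
    nlinarith [sq_nonneg (‖x n‖ - ‖y n‖), sq_nonneg (‖x n‖), sq_nonneg ‖y n‖]
  have hS : Summable fun n => vecFunctional M (y n) (x n) :=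
    Summable.of_norm_bounded hs fun n => norm_vecFunctional_le M _ _
  refine ⟨∑' n, vecFunctional M (y n) (x n), ?_, fun A => ?_⟩
  · exact (isClosed_normalFunctionals M).mem_of_tendsto hS.hasSum
      (Eventually.of_forall fun s => Submodule.sum_mem _ fun n _ => vecFunctional_mem M _ _)
  · exact (hS.hasSum.mapL (NormedSpace.inclusionInDoubleDual ℂ (Elt M) A)).unique (h A)

/-- The ultraweak topology is induced by the predual, and each `l ∘ φ` is again one of the inducing
functionals. -/
theorem weakStarContinuous_of_normal {φ : BoundedMap M}
    (h : ∀ l ∈ normalFunctionals M, l.comp φ ∈ normalFunctionals M) : WeakStarContinuous φ := by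
  unfold WeakStarContinuous ultraweakTopology
  refine continuous_iInf_rng.2 fun l => continuous_iInf_rng.2 fun hl => ?_
  refine continuous_induced_rng.2 ?_
  obtain ⟨f, hf, hfl⟩ := exists_normal_of_mem_predual hl
  refine continuous_iInf_dom (i := (f.comp φ : StrongDual ℂ (Elt M)).toLinearMap)
    (continuous_iInf_dom (i := mem_predual_of_mem_normal (h f hf)) ?_)
  have : ((fun A => l A) ∘ fun A => φ A) = fun A => (f.comp φ).toLinearMap A := by
    ext A
    exact (hfl _).symm
  rw [this]
  exact continuous_induced_dom

end Predual

/-! ### Positivity read off the quadratic form. -/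

section Positive

variable {H : Type*} [NormedAddCommGroup H] [InnerProductSpace ℂ H]

theorem isPositive_of_inner {P : H →L[ℂ] H} (r : H → ℝ) (hr : ∀ v, 0 ≤ r v)
    (h : ∀ v, inner ℂ (P v) v = ((r v : ℝ) : ℂ)) : P.IsPositive := by
  rw [ContinuousLinearMap.isPositive_iff_complex]
  intro v
  rw [h v]
  simpa using hr v

end Positive

/-! ### The Hilbert space `L²(M, τ)` and maps with a contractive preadjoint. -/

section Trace

variable {H : Type*} [NormedAddCommGroup H] [InnerProductSpace ℂ H] [CompleteSpace H]
variable {M : VonNeumannAlgebra H} {τ : Elt M →ₗ[ℂ] ℂ}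

theorem inner_star_mul_self (X : Elt M) (v : H) :
    (inner ℂ (((star X * X : Elt M) : H →L[ℂ] H) v) v : ℂ) =
      ((‖(X : H →L[ℂ] H) v‖ ^ 2 : ℝ) : ℂ) := by
  have : ((star X * X : Elt M) : H →L[ℂ] H) =
      ContinuousLinearMap.adjoint (X : H →L[ℂ] H) * (X : H →L[ℂ] H) := rfl
  rw [this, mul_apply_eq_comp, ContinuousLinearMap.adjoint_inner_left,
    inner_self_eq_norm_sq_to_K]
  norm_cast

theorem isPositive_star_mul_self (X : Elt M) : ((star X * X : Elt M) : H →L[ℂ] H).IsPositive :=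
  isPositive_of_inner _ (fun _ => sq_nonneg _) (inner_star_mul_self X)

namespace IsFaithfulNormalTrace

theorem re_nonneg (hτ : IsFaithfulNormalTrace τ) (X : Elt M) : 0 ≤ (τ (star X * X)).re :=
  (hτ.nonneg _ (isPositive_star_mul_self X)).1

theorem im_eq_zero (hτ : IsFaithfulNormalTrace τ) (X : Elt M) : (τ (star X * X)).im = 0 :=
  (hτ.nonneg _ (isPositive_star_mul_self X)).2

theorem eq_zero_of (hτ : IsFaithfulNormalTrace τ) {X : Elt M} (h : τ (star X * X) = 0) :
    X = 0 := by
  have h1 := hτ.faithful _ (isPositive_star_mul_self X) h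
  apply Subtype.ext
  ext v
  have h2 := inner_star_mul_self X v
  rw [h1, ZeroMemClass.coe_zero, zero_apply, inner_zero_left] at h2
  have h3 : ‖(X : H →L[ℂ] H) v‖ ^ 2 = 0 := by exact_mod_cast h2.symm
  simpa using h3

/-- Polarization: reality of `τ` on the squares of `1 + X` and `1 + iX` compares the imaginary and
the real parts. -/
theorem map_star (hτ : IsFaithfulNormalTrace τ) (X : Elt M) : τ (star X) = star (τ X) := by
  have h1 := hτ.im_eq_zero (1 + X)
  have h2 := hτ.im_eq_zero (1 + Complex.I • X)
  have h0 := hτ.im_eq_zero 1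
  have hX := hτ.im_eq_zero X
  have e1 : star (1 + X) * (1 + X) = star 1 * 1 + X + star X + star X * X := by
    simp only [star_add, star_one]; noncomm_ring
  have e2 : star (1 + Complex.I • X) * (1 + Complex.I • X) =
      star 1 * 1 + Complex.I • X - Complex.I • star X + star X * X := by
    simp [add_mul, mul_add, smul_smul]
    abel
  rw [e1] at h1
  rw [e2] at h2
  simp only [map_add, map_sub, map_smul, Complex.add_im, Complex.sub_im, smul_eq_mul,
    Complex.mul_im, Complex.I_re, Complex.I_im, zero_mul, one_mul, zero_add] at h1 h2
  apply Complex.ext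
  · simp only [RCLike.star_def, Complex.conj_re]; linarith
  · simp only [RCLike.star_def, Complex.conj_im]; linarith

/-- The trace is monotone, and `X* A* A X ≤ ‖A‖² X* X` as quadratic forms. -/
theorem re_conj_le (hτ : IsFaithfulNormalTrace τ) (A X : Elt M) :
    (τ (star (A * X) * (A * X))).re ≤ ‖A‖ ^ 2 * (τ (star X * X)).re := by
  let P : Elt M := ((‖A‖ ^ 2 : ℝ) : ℂ) • (star X * X) - star (A * X) * (A * X)
  have h : (P : H →L[ℂ] H).IsPositive := by
    refine isPositive_of_inner
      (fun v => ‖A‖ ^ 2 * ‖(X : H →L[ℂ] H) v‖ ^ 2 - ‖((A * X : Elt M) : H →L[ℂ] H) v‖ ^ 2)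
      (fun v => ?_) fun v => ?_
    · have : ‖((A * X : Elt M) : H →L[ℂ] H) v‖ ≤ ‖A‖ * ‖(X : H →L[ℂ] H) v‖ :=
        (A : H →L[ℂ] H).le_opNorm _
      rw [← mul_pow]
      exact sub_nonneg.2 (pow_le_pow_left₀ (norm_nonneg _) this 2)
    · have : (P : H →L[ℂ] H) v = ((‖A‖ ^ 2 : ℝ) : ℂ) • ((star X * X : Elt M) : H →L[ℂ] H) v -
          ((star (A * X) * (A * X) : Elt M) : H →L[ℂ] H) v := rfl
      rw [this, inner_sub_left, inner_smul_left, inner_star_mul_self, inner_star_mul_self,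
        Complex.conj_ofReal]
      push_cast
      rfl
  have h2 := (hτ.nonneg P h).1
  rw [map_sub, map_smul, smul_eq_mul, Complex.sub_re, Complex.re_ofReal_mul] at h2
  linarith

end IsFaithfulNormalTrace

/-- The algebra `M` with the inner product `τ (X* Y)`. -/
def TraceSpace (_ : IsFaithfulNormalTrace τ) : Type _ := Elt M

variable (hτ : IsFaithfulNormalTrace τ)

noncomputable instance : AddCommGroup (TraceSpace hτ) := inferInstanceAs (AddCommGroup (Elt M))

noncomputable instance : Module ℂ (TraceSpace hτ) := inferInstanceAs (Module ℂ (Elt M))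

/-- `M` as a space with inner product. -/
noncomputable def toTraceSpace : Elt M ≃ₗ[ℂ] TraceSpace hτ := LinearEquiv.refl ℂ (Elt M)

/-- The inner product `τ (X* Y)`. -/
@[reducible] noncomputable def traceSpaceCore : InnerProductSpace.Core ℂ (TraceSpace hτ) where
  inner X Y := τ (star ((toTraceSpace hτ).symm X) * (toTraceSpace hτ).symm Y)
  conj_inner_symm X Y := by
    rw [starRingEnd_apply, ← hτ.map_star, star_mul, star_star]
  re_inner_nonneg X := hτ.re_nonneg _
  add_left X Y Z := by rw [map_add, star_add, add_mul, map_add]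
  smul_left X Y a := by
    rw [map_smul, star_smul, smul_mul_assoc, map_smul, smul_eq_mul, starRingEnd_apply]
  definite X h := by
    have := hτ.eq_zero_of h
    simpa using this

noncomputable instance : NormedAddCommGroup (TraceSpace hτ) :=
  @InnerProductSpace.Core.toNormedAddCommGroup ℂ _ _ _ _ (traceSpaceCore hτ)

noncomputable instance : InnerProductSpace ℂ (TraceSpace hτ) :=
  InnerProductSpace.ofCore (traceSpaceCore hτ).toCore

/-- The Hilbert space `L²(M, τ)`. -/
abbrev L2 : Type _ := UniformSpace.Completion (TraceSpace hτ)

/-- The inclusion of `M` into `L²(M, τ)`. -/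
noncomputable def toL2 : Elt M →ₗ[ℂ] L2 hτ :=
  (UniformSpace.Completion.toComplₗᵢ (𝕜 := ℂ) (E := TraceSpace hτ)).toLinearMap ∘ₗ
    (toTraceSpace hτ).toLinearMap

theorem inner_toL2 (X Y : Elt M) : inner ℂ (toL2 hτ X) (toL2 hτ Y) = τ (star X * Y) :=
  UniformSpace.Completion.inner_coe _ _

theorem norm_toL2_sq (X : Elt M) : ‖toL2 hτ X‖ ^ 2 = (τ (star X * X)).re := by
  rw [← inner_toL2 hτ, inner_self_eq_norm_sq_to_K]
  norm_cast

theorem denseRange_toL2 : DenseRange (toL2 hτ) := by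
  have h := UniformSpace.Completion.denseRange_coe (α := TraceSpace hτ)
  exact h.comp (toTraceSpace hτ).surjective.denseRange
    (UniformSpace.Completion.continuous_coe _)

theorem norm_toL2_mul_left (A X : Elt M) : ‖toL2 hτ (A * X)‖ ≤ ‖A‖ * ‖toL2 hτ X‖ := by
  refine (pow_le_pow_iff_left₀ (norm_nonneg _) (by positivity) two_ne_zero).1 ?_
  rw [mul_pow, norm_toL2_sq, norm_toL2_sq]
  exact hτ.re_conj_le A X

/-- Traciality makes the adjoint an `L²` isometry, which carries the bound for left multiplication
over to right multiplication. -/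
theorem norm_toL2_star (X : Elt M) : ‖toL2 hτ (star X)‖ = ‖toL2 hτ X‖ := by
  have : ‖toL2 hτ (star X)‖ ^ 2 = ‖toL2 hτ X‖ ^ 2 := by
    rw [norm_toL2_sq, norm_toL2_sq, star_star, hτ.tracial]
  exact (pow_left_inj₀ (norm_nonneg _) (norm_nonneg _) two_ne_zero).1 this

theorem norm_toL2_mul_right (X B : Elt M) : ‖toL2 hτ (X * B)‖ ≤ ‖B‖ * ‖toL2 hτ X‖ := by
  rw [← norm_toL2_star, star_mul, ← norm_toL2_star hτ X, ← norm_star B]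
  exact norm_toL2_mul_left hτ _ _

theorem norm_toL2_le (X : Elt M) : ‖toL2 hτ X‖ ≤ ‖toL2 hτ 1‖ * ‖X‖ := by
  have := norm_toL2_mul_left hτ X 1
  rwa [mul_one, mul_comm] at this

include hτ in
theorem exists_traceFunctional (Y : Elt M) :
    ∃ f ∈ normalFunctionals M, ∀ X, f X = τ (Y * X) := by
  obtain ⟨f, hf, h⟩ := exists_normal_of_mem_predual hτ.normal
  exact ⟨_, comp_mulLeftRight_mem Y 1 hf, fun X => by
    rw [ContinuousLinearMap.comp_apply, h]; simp⟩

/-- The functional `X ↦ τ (Y X)`. -/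
noncomputable def traceFunctional (Y : Elt M) : StrongDual ℂ (Elt M) :=
  (exists_traceFunctional hτ Y).choose

theorem traceFunctional_mem (Y : Elt M) : traceFunctional hτ Y ∈ normalFunctionals M :=
  (exists_traceFunctional hτ Y).choose_spec.1

theorem traceFunctional_apply (Y X : Elt M) : traceFunctional hτ Y X = τ (Y * X) :=
  (exists_traceFunctional hτ Y).choose_spec.2 X

/-- A normal functional is `L²`-continuous on balls. -/
theorem exists_delta_of_normal {l : StrongDual ℂ (Elt M)} (hl : l ∈ normalFunctionals M)
    {R ε : ℝ} (hR : 0 ≤ R) (hε : 0 < ε) :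
    ∃ δ > 0, ∀ X : Elt M, ‖X‖ ≤ R → ‖toL2 hτ X‖ ≤ δ → ‖l X‖ < ε := by
  -- Otherwise some sequence in the ball tends to `0` in `L²` while `|l|` stays at least `ε`. An
  -- ultraweak cluster point `Y` satisfies `τ(Y* Y) = lim ⟨Y, X n⟩ = 0`, so `Y = 0`, contradicting
  -- normality of `l`.
  by_contra! hcon
  have hpos : ∀ n : ℕ, (0 : ℝ) < 1 / ((n : ℝ) + 1) := fun n => by positivity
  choose X hXR hXδ hXε using fun n : ℕ => hcon _ (hpos n)
  obtain ⟨Y, -, hY⟩ := exists_ultraweak_limit (Ultrafilter.of atTop) X R hR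
    (Eventually.of_forall hXR)
  have hsmall : Tendsto (fun n => toL2 hτ (X n)) atTop (𝓝 0) :=
    squeeze_zero_norm hXδ tendsto_one_div_add_atTop_nhds_zero_nat
  have h1 : Tendsto (fun n => traceFunctional hτ (star Y) (X n))
      (Ultrafilter.of (atTop : Filter ℕ) : Filter ℕ) (𝓝 0) := by
    have h := (tendsto_const_nhds (x := toL2 hτ Y)).inner (𝕜 := ℂ) hsmall
    rw [inner_zero_right] at h
    exact (h.congr fun n => by rw [inner_toL2, traceFunctional_apply]).mono_left
      (Ultrafilter.of_le _)
  have h2 := tendsto_nhds_unique (hY _ (traceFunctional_mem hτ (star Y))) h1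
  rw [traceFunctional_apply] at h2
  have hY0 := hτ.eq_zero_of h2
  have h3 := (hY l hl).norm
  rw [hY0, map_zero, norm_zero] at h3
  exact absurd (ge_of_tendsto h3 (Eventually.of_forall hXε)) (not_le.2 hε)

/-- The functionals `τ (Y ·)` span a dense subspace of the normal functionals. -/
theorem normal_le_of_traceFunctional {V : Submodule ℂ (StrongDual ℂ (Elt M))}
    (hV : IsClosed (V : Set (StrongDual ℂ (Elt M)))) (h : ∀ Y, traceFunctional hτ Y ∈ V) :
    normalFunctionals M ≤ V := by
  intro l hl
  -- Hahn–Banach: a functional vanishing on `V` acts on normal functionals as evaluation at some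
  -- `X`. Testing it on `τ(X* ·) ∈ V` forces `X = 0`.
  obtain ⟨g, -, hg⟩ := exists_dual_vector'' ℂ (V.mkQ l)
  let F : StrongDual ℂ (StrongDual ℂ (Elt M)) := LinearMap.mkContinuous
    (g.toLinearMap ∘ₗ V.mkQ) ‖g‖ fun b => by
      refine (g.le_opNorm _).trans ?_
      gcongr
      exact Submodule.Quotient.norm_mk_le _ b
  obtain ⟨X, hX⟩ := exists_elt_of_bidual F
  have hFV : ∀ f ∈ V, F f = 0 := fun f hf => by
    change g (V.mkQ f) = 0
    rw [Submodule.mkQ_apply, (Submodule.Quotient.mk_eq_zero V).2 hf, map_zero]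
  have h1 := hX _ (traceFunctional_mem hτ (star X))
  rw [hFV _ (h _), traceFunctional_apply] at h1
  have hX0 := hτ.eq_zero_of h1.symm
  have h2 : g (V.mkQ l) = l X := hX l hl
  rw [hX0, map_zero, hg] at h2
  have h3 : ‖V.mkQ l‖ = 0 := RCLike.ofReal_eq_zero.1 h2
  have h4 : V.mkQ l = 0 := (norm_eq_zero (E := StrongDual ℂ (Elt M) ⧸ V)).1 h3
  exact (Submodule.Quotient.mk_eq_zero V).1 h4

/-- `φ` is a contraction whose preadjoint acts as a contraction on the functionals `τ (X ·)`. -/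
structure IsContractive (τ : Elt M →ₗ[ℂ] ℂ) (φ : BoundedMap M) : Prop where
  norm_le : ‖φ‖ ≤ 1
  exists_dual : ∀ X : Elt M, ∃ Z : Elt M, ‖Z‖ ≤ ‖X‖ ∧ ∀ Y, τ (X * φ Y) = τ (Z * Y)

include hτ in
-- The preadjoint keeps the dense family `τ(X ·)` inside the normal functionals. This gives
-- normality of limit maps, which pointwise convergence alone would not.
theorem IsContractive.comp_mem {φ : BoundedMap M} (hφ : IsContractive τ φ)
    {l : StrongDual ℂ (Elt M)} (hl : l ∈ normalFunctionals M) :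
    l.comp φ ∈ normalFunctionals M := by
  refine normal_le_of_traceFunctional hτ (V := (normalFunctionals M).comap
      ((ContinuousLinearMap.compL ℂ (Elt M) (Elt M) ℂ).flip φ).toLinearMap)
    (IsClosed.preimage (f := (ContinuousLinearMap.compL ℂ (Elt M) (Elt M) ℂ).flip φ)
      (ContinuousLinearMap.continuous _) (isClosed_normalFunctionals M)) (fun X => ?_) hl
  obtain ⟨Z, -, hZ⟩ := hφ.exists_dual X
  have : (traceFunctional hτ X).comp φ = traceFunctional hτ Z := by
    ext Y
    rw [ContinuousLinearMap.comp_apply, traceFunctional_apply, traceFunctional_apply, hZ]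
  change (traceFunctional hτ X).comp φ ∈ normalFunctionals M
  rw [this]
  exact traceFunctional_mem hτ Z

include hτ in
theorem IsContractive.isStableFor {φ : BoundedMap M} (hφ : IsContractive τ φ) :
    IsStableFor τ φ :=
  ⟨weakStarContinuous_of_normal fun _ hl => hφ.comp_mem hτ hl, fun X =>
    (hφ.exists_dual X).imp fun _ h => h.2⟩

theorem IsContractive.mul {φ ψ : BoundedMap M} (hφ : IsContractive τ φ)
    (hψ : IsContractive τ ψ) : IsContractive τ (φ * ψ) where
  norm_le := (norm_mul_le _ _).trans (mul_le_one₀ hφ.norm_le (norm_nonneg _) hψ.norm_le)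
  exists_dual X := by
    obtain ⟨Z, hZ, h⟩ := hφ.exists_dual X
    obtain ⟨W, hW, h'⟩ := hψ.exists_dual Z
    exact ⟨W, hW.trans hZ, fun Y => (h (ψ Y)).trans (h' Y)⟩

include hτ in
/-- Pointwise ultraweak limits of contractive maps are contractive. -/
theorem IsContractive.of_tendsto {ι : Type*} (U : Ultrafilter ι) {φ : ι → BoundedMap M}
    (hφ : ∀ i, IsContractive τ (φ i)) {ψ : BoundedMap M} (hψ : ‖ψ‖ ≤ 1)
    (h : ∀ l ∈ normalFunctionals M, ∀ X, Tendsto (fun i => l (φ i X)) U (𝓝 (l (ψ X)))) :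
    IsContractive τ ψ where
  norm_le := hψ
  exists_dual X := by
    choose Z hZ hZX using fun i => (hφ i).exists_dual X
    -- The bound `‖Z i‖ ≤ ‖X‖`, uniform in `i`, is what makes a limit of the representing elements
    -- available.
    obtain ⟨W, hW, hlim⟩ := exists_ultraweak_limit U Z _ (norm_nonneg X)
      (Eventually.of_forall hZ)
    refine ⟨W, hW, fun Y => ?_⟩
    have h1 := h _ (traceFunctional_mem hτ X) Y
    have h2 := hlim _ (traceFunctional_mem hτ Y)
    simp only [traceFunctional_apply] at h1 h2
    rw [hτ.tracial W Y]
    exact tendsto_nhds_unique h1 (h2.congr fun i => by rw [hZX, hτ.tracial])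

/-- `L²`-contractivity passes to pointwise ultraweak limits. -/
theorem norm_toL2_le_of_tendsto {ι : Type*} {F : Filter ι} [F.NeBot] {f : ι → Elt M} {X : Elt M}
    {C : ℝ} (h : ∀ l ∈ normalFunctionals M, Tendsto (fun i => l (f i)) F (𝓝 (l X)))
    (hf : ∀ i, ‖toL2 hτ (f i)‖ ≤ C) : ‖toL2 hτ X‖ ≤ C := by
  have h1 := (h _ (traceFunctional_mem hτ (star X))).norm
  have h2 : ‖traceFunctional hτ (star X) X‖ ≤ ‖toL2 hτ X‖ * C := by
    refine le_of_tendsto h1 (Eventually.of_forall fun i => ?_)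
    rw [traceFunctional_apply, ← inner_toL2 hτ]
    exact (norm_inner_le_norm _ _).trans (by gcongr; exact hf i)
  rw [traceFunctional_apply, ← inner_toL2 hτ, inner_self_eq_norm_sq_to_K, norm_pow,
    RCLike.norm_ofReal, abs_norm, sq] at h2
  rcases (norm_nonneg (toL2 hτ X)).eq_or_lt with h0 | h0
  · rw [← h0]
    obtain ⟨i⟩ : Nonempty ι := F.nonempty_of_neBot
    exact (norm_nonneg _).trans (hf i)
  · exact le_of_mul_le_mul_left h2 h0

end Trace

/-! ### Window averages of scalar sequences and of gauge weights. -/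

section Averages

/-- The averages of `n + 1` consecutive terms of `e` have upper limit at most `0` as `n → ∞`,
uniformly in the position. -/
def UniformlyAverageZero (e : ℕ → ℝ) : Prop :=
  ∀ ε : ℝ, 0 < ε → ∃ N : ℕ, ∀ n ≥ N, ∀ k, ∑ i ∈ Finset.range (n + 1), e (k + i) ≤ ε * (n + 1)

theorem UniformlyAverageZero.mono {e e' : ℕ → ℝ} (h : UniformlyAverageZero e) {K : ℝ}
    (hK : 0 < K) (h' : ∀ i, e' i ≤ K * e i) : UniformlyAverageZero e' := by
  intro ε hε
  obtain ⟨N, hN⟩ := h (ε / K) (by positivity)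
  refine ⟨N, fun n hn k => ?_⟩
  calc ∑ i ∈ Finset.range (n + 1), e' (k + i)
      ≤ ∑ i ∈ Finset.range (n + 1), K * e (k + i) := Finset.sum_le_sum fun i _ => h' _
    _ = K * ∑ i ∈ Finset.range (n + 1), e (k + i) := (Finset.mul_sum _ _ _).symm
    _ ≤ K * (ε / K * (n + 1)) := by gcongr; exact hN n hn k
    _ = ε * (n + 1) := by field_simp

theorem norm_natCast_add_one (n : ℕ) : ‖((n : ℂ) + 1)‖ = (n : ℝ) + 1 := by
  have : ((n : ℂ) + 1) = ((n + 1 : ℕ) : ℂ) := by push_cast; ring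
  rw [this, Complex.norm_natCast]
  push_cast
  ring

theorem norm_average_le_sum {V : Type*} [NormedAddCommGroup V] [NormedSpace ℂ V] (v : ℕ → V)
    (n : ℕ) {C : ℝ} (h : ∑ i ∈ Finset.range (n + 1), ‖v i‖ ≤ C * (n + 1)) :
    ‖((n : ℂ) + 1)⁻¹ • ∑ i ∈ Finset.range (n + 1), v i‖ ≤ C := by
  rw [norm_smul, norm_inv, norm_natCast_add_one, inv_mul_le_iff₀ (by positivity), mul_comm]
  exact (norm_sum_le _ _).trans h

theorem norm_average_le {V : Type*} [NormedAddCommGroup V] [NormedSpace ℂ V] {v : ℕ → V} (n : ℕ)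
    {C : ℝ} (h : ∀ i, ‖v i‖ ≤ C) :
    ‖((n : ℂ) + 1)⁻¹ • ∑ i ∈ Finset.range (n + 1), v i‖ ≤ C := by
  refine norm_average_le_sum v n ((Finset.sum_le_sum fun i _ => h i).trans ?_)
  simp [mul_comm]

theorem average_const {V : Type*} [NormedAddCommGroup V] [NormedSpace ℂ V] (v : V) (n : ℕ) :
    ((n : ℂ) + 1)⁻¹ • ∑ _i ∈ Finset.range (n + 1), v = v := by
  rw [Finset.sum_const, Finset.card_range, ← Nat.cast_smul_eq_nsmul ℂ, smul_smul]
  push_cast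
  rw [inv_mul_cancel₀ (Nat.cast_add_one_ne_zero n), one_smul]

theorem StronglyAlmostConvergesTo.bounded {u : ℕ → ℂ} {c : ℂ}
    (h : StronglyAlmostConvergesTo u c) : ∃ C, ∀ n, ‖u n - c‖ ≤ C := by
  obtain ⟨C, hC⟩ := h.1
  exact ⟨C, fun n => by simpa using hC n⟩

theorem StronglyAlmostConvergesTo.uniformlyAverageZero {u : ℕ → ℂ} {c : ℂ}
    (h : StronglyAlmostConvergesTo u c) : UniformlyAverageZero fun n => ‖u n - c‖ := by
  intro ε hε
  obtain ⟨N, hN⟩ := eventually_atTop.1 (Metric.tendstoUniformly_iff.1 h.2 ε hε)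
  refine ⟨N, fun n hn k => ?_⟩
  have h1 := hN n hn k
  rw [dist_zero_left, norm_mul, norm_inv, norm_natCast_add_one, ← Complex.ofReal_sum,
    Complex.norm_real, inv_mul_lt_iff₀ (by positivity), mul_comm] at h1
  exact (le_abs_self _).trans h1.le

/-- Almost convergence to `0` may be tested after a shift. -/
theorem almostConvergesTo_zero_of_shift {u : ℕ → ℂ} {C : ℝ} (hC : ∀ n, ‖u n‖ ≤ C)
    (h : ∀ ε : ℝ, 0 < ε → ∃ N : ℕ, ∀ n ≥ N, ∀ k,
      ‖((n : ℂ) + 1)⁻¹ * ∑ i ∈ Finset.range (n + 1), u (k + 1 + i)‖ ≤ ε) :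
    AlmostConvergesTo u 0 := by
  refine ⟨⟨C, hC⟩, Metric.tendstoUniformly_iff.2 fun ε hε => ?_⟩
  have hC0 : 0 ≤ C := (norm_nonneg _).trans (hC 0)
  obtain ⟨N, hN⟩ := h (ε / 2) (by positivity)
  obtain ⟨N', hN'⟩ := exists_nat_gt (2 * C / (ε / 2))
  filter_upwards [eventually_ge_atTop (max N N')] with n hn k
  rw [dist_zero_left]
  -- Moving the window by one place exchanges two terms, an error of at most `2C` that disappears
  -- after division by `n + 1`.
  have e : ∑ i ∈ Finset.range (n + 1), u (k + i) =
      ∑ i ∈ Finset.range (n + 1), u (k + 1 + i) + (u k - u (k + 1 + n)) := by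
    have h1 := Finset.sum_range_succ (fun i => u (k + i)) (n + 1)
    rw [Finset.sum_range_succ' (fun i => u (k + i)) (n + 1)] at h1
    have h2 : ∀ i, u (k + (i + 1)) = u (k + 1 + i) := fun i => by congr 1; ring
    simp only [h2, add_zero] at h1
    linear_combination -h1
  rw [e, mul_add]
  refine (norm_add_le _ _).trans_lt ?_
  have h1 := hN n ((le_max_left _ _).trans hn) k
  have h2 : ‖((n : ℂ) + 1)⁻¹ * (u k - u (k + 1 + n))‖ < ε / 2 := by
    rw [norm_mul, norm_inv, norm_natCast_add_one, inv_mul_lt_iff₀ (by positivity)]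
    have h3 : (N' : ℝ) ≤ n := by exact_mod_cast (le_max_right _ _).trans hn
    have h4 := (div_lt_iff₀ (by positivity)).1 hN'
    have h5 := (norm_sub_le (u k) (u (k + 1 + n))).trans (add_le_add (hC _) (hC _))
    nlinarith
  linarith

theorem abs_sq_sub_one_le {a C : ℝ} (h : |a - 1| ≤ C) :
    |a ^ 2 - 1| ≤ (C + 2) * |a - 1| := by
  have e : a ^ 2 - 1 = (a - 1 + 2) * (a - 1) := by ring
  rw [e, abs_mul]
  gcongr
  refine (abs_add_le _ _).trans ?_
  rw [abs_two]
  linarith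

/-- The weights `c ^ (2 n) / p(n) ^ 2` of a gauge. -/
noncomputable def gaugeWeight (p : ℕ → ℝ) (c : ℝ) (n : ℕ) : ℝ := (c ^ n / p n) ^ 2

variable {p : ℕ → ℝ} {c : ℝ}

/-- Strong almost convergence survives squaring: for a bounded sequence `|a² - 1|` is at most a
constant times `|a - 1|`. -/
theorem IsRegularGauge.uniformlyAverageZero_weight (hp : IsRegularGauge p c) :
    UniformlyAverageZero fun n => |gaugeWeight p c n - 1| := by
  obtain ⟨C, hC⟩ := hp.2.bounded
  have e : ∀ n, ‖((c ^ n / p n : ℝ) : ℂ) - 1‖ = |c ^ n / p n - 1| := fun n => by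
    rw [← Complex.ofReal_one, ← Complex.ofReal_sub, Complex.norm_real, Real.norm_eq_abs]
  have hC0 : 0 ≤ C := (norm_nonneg _).trans (hC 0)
  refine hp.2.uniformlyAverageZero.mono (K := C + 2) (by positivity) fun n => ?_
  rw [e]
  exact abs_sq_sub_one_le (by rw [← e]; exact hC n)

/-- The ratio equals the square of `p(n+1) / (c p(n))`, so only the gauge condition on consecutive
quotients enters. -/
theorem IsRegularGauge.uniformlyAverageZero_ratio (hp : IsRegularGauge p c) :
    UniformlyAverageZero fun n => |gaugeWeight p c n / gaugeWeight p c (n + 1) - 1| := by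
  obtain ⟨C, hC⟩ := hp.1.2.2.bounded
  have hc := hp.1.2.1
  have e : ∀ n, |p (n + 1) / p n / c - 1| =
      c⁻¹ * ‖((p (n + 1) / p n : ℝ) : ℂ) - c‖ := fun n => by
    have : p (n + 1) / p n / c - 1 = c⁻¹ * (p (n + 1) / p n - c) := by field_simp
    rw [← Complex.ofReal_sub, Complex.norm_real, Real.norm_eq_abs, this, abs_mul,
      abs_of_pos (inv_pos.2 hc)]
  have hC0 : 0 ≤ C := (norm_nonneg _).trans (hC 0)
  refine hp.1.2.2.uniformlyAverageZero.mono (K := (c⁻¹ * C + 2) * c⁻¹) (by positivity)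
    fun n => ?_
  have e2 : gaugeWeight p c n / gaugeWeight p c (n + 1) = (p (n + 1) / p n / c) ^ 2 := by
    have h1 := (hp.1.1 n).ne'
    have h2 := (hp.1.1 (n + 1)).ne'
    have h3 := hc.ne'
    unfold gaugeWeight
    field_simp
    ring
  rw [e2, mul_assoc, ← e]
  refine abs_sq_sub_one_le ?_
  rw [e]
  gcongr
  exact hC n

end Averages

/-! ### The class of admissible maps and its closure properties. -/

section Maps

variable {H : Type*} [NormedAddCommGroup H] [InnerProductSpace ℂ H] [CompleteSpace H]
variable {M : VonNeumannAlgebra H}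

/-- The average of `n + 1` consecutive maps, starting with `φ k`. -/
noncomputable def averageMap (φ : ℕ → BoundedMap M) (k n : ℕ) : BoundedMap M :=
  ((n : ℂ) + 1)⁻¹ • ∑ i ∈ Finset.range (n + 1), φ (k + i)

theorem averageMap_apply (φ : ℕ → BoundedMap M) (k n : ℕ) (X : Elt M) :
    averageMap φ k n X = ((n : ℂ) + 1)⁻¹ • ∑ i ∈ Finset.range (n + 1), φ (k + i) X := by
  simp [averageMap]

theorem map_averageMap {V : Type*} [NormedAddCommGroup V] [NormedSpace ℂ V]
    (φ : ℕ → BoundedMap M) (f : Elt M →ₗ[ℂ] V) (k n : ℕ) (X : Elt M) :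
    f (averageMap φ k n X) = ((n : ℂ) + 1)⁻¹ • ∑ i ∈ Finset.range (n + 1), f (φ (k + i) X) := by
  rw [averageMap_apply, map_smul, map_sum]

/-- Maps with the properties that are shared by all maps `X ↦ p(n)⁻² T*ⁿ X Tⁿ`, `n ≥ 1`, `T ∈ S`,
and inherited by their products, averages and limits. -/
structure IsAdmissible (S : Set (Elt M)) (φ : BoundedMap M) : Prop where
  contractive : ∀ τ : Elt M →ₗ[ℂ] ℂ, IsFaithfulNormalTrace τ → IsContractive τ φ
  norm_toL2_le : ∀ (τ : Elt M →ₗ[ℂ] ℂ) (hτ : IsFaithfulNormalTrace τ) (X : Elt M),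
    ‖toL2 hτ (φ X)‖ ≤ ‖toL2 hτ X‖
  completelyPositive : IsCompletelyPositive φ
  bimodule : ∀ A B : H →L[ℂ] H,
    (∀ T ∈ S, A * (T : H →L[ℂ] H) = (T : H →L[ℂ] H) * A) →
    (∀ T ∈ S, B * (T : H →L[ℂ] H) = (T : H →L[ℂ] H) * B) →
    ∀ X Y : Elt M, (Y : H →L[ℂ] H) = star A * (X : H →L[ℂ] H) * B →
      (φ Y : H →L[ℂ] H) = star A * (φ X : H →L[ℂ] H) * B

variable {S : Set (Elt M)}

theorem IsAdmissible.mul {φ ψ : BoundedMap M} (hφ : IsAdmissible S φ) (hψ : IsAdmissible S ψ) :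
    IsAdmissible S (φ * ψ) where
  contractive τ hτ := (hφ.contractive τ hτ).mul (hψ.contractive τ hτ)
  norm_toL2_le τ hτ X := (hφ.norm_toL2_le τ hτ _).trans (hψ.norm_toL2_le τ hτ X)
  completelyPositive n A hA := hφ.completelyPositive n _ (hψ.completelyPositive n A hA)
  bimodule A B hA hB X Y h := hφ.bimodule A B hA hB _ _ (hψ.bimodule A B hA hB X Y h)

theorem IsContractive.average {τ : Elt M →ₗ[ℂ] ℂ} {φ : ℕ → BoundedMap M} {k : ℕ}
    (hφ : ∀ i, IsContractive τ (φ (k + i))) (n : ℕ) : IsContractive τ (averageMap φ k n) where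
  norm_le := norm_average_le n fun i => (hφ i).norm_le
  exists_dual X := by
    choose Z hZ h using fun i => (hφ i).exists_dual X
    refine ⟨((n : ℂ) + 1)⁻¹ • ∑ i ∈ Finset.range (n + 1), Z i, norm_average_le n hZ,
      fun Y => ?_⟩
    rw [averageMap_apply, mul_smul_comm, map_smul, Finset.mul_sum, map_sum, smul_mul_assoc,
      map_smul, Finset.sum_mul, map_sum]
    simp only [h]

theorem isCompletelyPositive_average {φ : ℕ → BoundedMap M} {k : ℕ}
    (hφ : ∀ i, IsCompletelyPositive (φ (k + i))) (n : ℕ) :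
    IsCompletelyPositive (averageMap φ k n) := by
  intro m A hA x
  have e : ∑ i, ∑ j, inner ℂ (x i) ((averageMap φ k n (A i j) : H →L[ℂ] H) (x j)) =
      (((n + 1 : ℝ)⁻¹ : ℝ) : ℂ) * ∑ q ∈ Finset.range (n + 1),
        ∑ i, ∑ j, inner ℂ (x i) ((φ (k + q) (A i j) : H →L[ℂ] H) (x j)) := by
    have h : ∀ i j, (inner ℂ (x i) ((averageMap φ k n (A i j) : H →L[ℂ] H) (x j)) : ℂ) =
        ((n : ℂ) + 1)⁻¹ * ∑ q ∈ Finset.range (n + 1),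
          inner ℂ (x i) ((φ (k + q) (A i j) : H →L[ℂ] H) (x j)) := fun i j =>
      map_averageMap φ (vecFunctional M (x i) (x j)).toLinearMap k n (A i j)
    simp only [h, ← Finset.mul_sum]
    push_cast
    congr 1
    rw [Finset.sum_comm]
    conv_rhs => rw [Finset.sum_comm]
    rw [Finset.sum_comm]
    exact Finset.sum_congr rfl fun i _ => Finset.sum_comm
  rw [e, Complex.re_ofReal_mul, Complex.im_ofReal_mul, Complex.re_sum, Complex.im_sum]
  refine ⟨mul_nonneg (by positivity) (Finset.sum_nonneg fun q _ => (hφ q m A hA x).1), ?_⟩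
  rw [Finset.sum_eq_zero fun q _ => (hφ q m A hA x).2, mul_zero]

theorem IsAdmissible.average {φ : ℕ → BoundedMap M} {k : ℕ}
    (hφ : ∀ i, IsAdmissible S (φ (k + i))) (n : ℕ) : IsAdmissible S (averageMap φ k n) where
  contractive τ hτ := IsContractive.average (fun i => (hφ i).contractive τ hτ) n
  norm_toL2_le τ hτ X := by
    rw [map_averageMap]
    exact norm_average_le n fun i => (hφ i).norm_toL2_le τ hτ X
  completelyPositive := isCompletelyPositive_average (fun i => (hφ i).completelyPositive) n
  bimodule A B hA hB X Y h := by
    have h1 : ∀ Z : Elt M, (averageMap φ k n Z : H →L[ℂ] H) =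
        ((n : ℂ) + 1)⁻¹ • ∑ i ∈ Finset.range (n + 1), (φ (k + i) Z : H →L[ℂ] H) := fun Z =>
      map_averageMap φ M.toStarSubalgebra.subtype.toLinearMap k n Z
    rw [h1, h1, mul_smul_comm, smul_mul_assoc, Finset.mul_sum, Finset.sum_mul]
    congr 1
    exact Finset.sum_congr rfl fun i _ => (hφ i).bimodule A B hA hB X Y h

theorem isCompletelyPositive_of_tendsto {ι : Type*} {F : Filter ι} [F.NeBot]
    {φ : ι → BoundedMap M} (hφ : ∀ i, IsCompletelyPositive (φ i)) {ψ : BoundedMap M}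
    (h : ∀ l ∈ normalFunctionals M, ∀ X, Tendsto (fun i => l (φ i X)) F (𝓝 (l (ψ X)))) :
    IsCompletelyPositive ψ := by
  intro m A hA x
  have hlim : Tendsto (fun q => ∑ i, ∑ j, inner ℂ (x i) ((φ q (A i j) : H →L[ℂ] H) (x j))) F
      (𝓝 (∑ i, ∑ j, inner ℂ (x i) ((ψ (A i j) : H →L[ℂ] H) (x j)))) :=
    tendsto_finsetSum _ fun i _ => tendsto_finsetSum _ fun j _ =>
      h _ (vecFunctional_mem M (x i) (x j)) (A i j)
  constructor
  · exact ge_of_tendsto ((Complex.continuous_re.tendsto _).comp hlim)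
      (Eventually.of_forall fun q => (hφ q m A hA x).1)
  · refine tendsto_nhds_unique ((Complex.continuous_im.tendsto _).comp hlim) ?_
    exact tendsto_const_nhds.congr fun q => ((hφ q m A hA x).2).symm

theorem IsAdmissible.of_tendsto {ι : Type*} (U : Ultrafilter ι) {φ : ι → BoundedMap M}
    (hφ : ∀ i, IsAdmissible S (φ i)) {ψ : BoundedMap M} (hψ : ‖ψ‖ ≤ 1)
    (h : ∀ l ∈ normalFunctionals M, ∀ X, Tendsto (fun i => l (φ i X)) U (𝓝 (l (ψ X)))) :
    IsAdmissible S ψ where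
  contractive τ hτ := IsContractive.of_tendsto hτ U (fun i => (hφ i).contractive τ hτ) hψ h
  norm_toL2_le τ hτ X := norm_toL2_le_of_tendsto hτ (fun l hl => h l hl X)
    fun i => (hφ i).norm_toL2_le τ hτ X
  completelyPositive := isCompletelyPositive_of_tendsto (fun i => (hφ i).completelyPositive) h
  bimodule A B hA hB X Y hXY := by
    ext v
    refine ext_inner_left ℂ fun u => ?_
    have h1 := h _ (vecFunctional_mem M u v) Y
    have h2 := h _ (vecFunctional_mem M (A u) (B v)) X
    have e : ∀ Z : H →L[ℂ] H, (inner ℂ u ((star A * Z * B) v) : ℂ) = inner ℂ (A u) (Z (B v)) :=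
      fun Z => by
        rw [mul_apply_eq_comp, mul_apply_eq_comp, ContinuousLinearMap.star_eq_adjoint,
          ContinuousLinearMap.adjoint_inner_right]
    rw [e]
    refine tendsto_nhds_unique h1 (h2.congr fun i => ?_)
    rw [vecFunctional_apply, vecFunctional_apply, (hφ i).bimodule A B hA hB X Y hXY, e]

theorem conjSeq_apply (p : ℕ → ℝ) (T : Elt M) (n : ℕ) (X : Elt M) :
    conjSeq p T n X = (((p n ^ 2)⁻¹ : ℝ) : ℂ) • (star T ^ n * X * T ^ n) := by
  simp [conjSeq]

theorem norm_smul_conj_le {p : ℕ → ℝ} (hp : ∀ n, 0 < p n) {T : Elt M} (hT : IsDominatedBy T p)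
    {n : ℕ} (hn : 1 ≤ n) {V : Type*} [NormedAddCommGroup V] [NormedSpace ℂ V] {v : V} {r : ℝ}
    (hr : 0 ≤ r) (hv : ‖v‖ ≤ ‖T ^ n‖ * (‖T ^ n‖ * r)) :
    ‖(((p n ^ 2)⁻¹ : ℝ) : ℂ) • v‖ ≤ r := by
  have h0 := hp n
  rw [norm_smul, Complex.norm_real, Real.norm_of_nonneg (by positivity),
    inv_mul_le_iff₀ (by positivity), sq, mul_assoc]
  refine hv.trans ?_
  have := hT n hn
  gcongr

/-- Domination gives the contraction bounds, for `n ≥ 1` only. By traciality the preadjoint is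
conjugation the other way, `X ↦ p(n)⁻² Tⁿ X T*ⁿ`, with the same bound. The bimodule identity moves
`A` and `B` past powers of `T`. -/
theorem isAdmissible_conjSeq {p : ℕ → ℝ} (hp : ∀ n, 0 < p n) {T : Elt M} (hTS : T ∈ S)
    (hT : IsDominatedBy T p) {n : ℕ} (hn : 1 ≤ n) : IsAdmissible S (conjSeq p T n) where
  contractive τ hτ :=
    { norm_le := ContinuousLinearMap.opNorm_le_bound _ zero_le_one fun X => by
        rw [one_mul, conjSeq_apply]
        refine norm_smul_conj_le hp hT hn (norm_nonneg _) ?_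
        refine (norm_mul_le _ _).trans ?_
        rw [mul_comm]
        gcongr
        refine (norm_mul_le _ _).trans ?_
        rw [← star_pow, norm_star]
      exists_dual := fun X =>
        ⟨(((p n ^ 2)⁻¹ : ℝ) : ℂ) • (T ^ n * X * star T ^ n), by
          refine norm_smul_conj_le hp hT hn (norm_nonneg _) ?_
          refine (norm_mul_le _ _).trans ?_
          rw [mul_comm, ← star_pow, norm_star]
          gcongr
          exact norm_mul_le _ _, fun Y => by
          rw [conjSeq_apply, mul_smul_comm, smul_mul_assoc, map_smul, map_smul, ← mul_assoc,
            hτ.tracial, ← mul_assoc, ← mul_assoc]⟩ }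
  norm_toL2_le τ hτ X := by
    rw [conjSeq_apply, map_smul]
    refine norm_smul_conj_le hp hT hn (norm_nonneg _) ?_
    refine (norm_toL2_mul_right hτ _ _).trans ?_
    gcongr
    refine (norm_toL2_mul_left hτ _ _).trans ?_
    rw [← star_pow, norm_star]
  completelyPositive m A hA x := by
    have e : ∀ i j, (inner ℂ (x i) ((conjSeq p T n (A i j) : H →L[ℂ] H) (x j)) : ℂ) =
        (((p n ^ 2)⁻¹ : ℝ) : ℂ) * inner ℂ (((T ^ n : Elt M) : H →L[ℂ] H) (x i))
          ((A i j : H →L[ℂ] H) (((T ^ n : Elt M) : H →L[ℂ] H) (x j))) := fun i j => by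
      have : (conjSeq p T n (A i j) : H →L[ℂ] H) (x j) = (((p n ^ 2)⁻¹ : ℝ) : ℂ) •
          (ContinuousLinearMap.adjoint ((T ^ n : Elt M) : H →L[ℂ] H))
            ((A i j : H →L[ℂ] H) (((T ^ n : Elt M) : H →L[ℂ] H) (x j))) := by
        rw [conjSeq_apply, ← star_pow]
        rfl
      rw [this, inner_smul_right, ContinuousLinearMap.adjoint_inner_right]
    simp only [e, ← Finset.mul_sum]
    rw [Complex.re_ofReal_mul, Complex.im_ofReal_mul]
    have := hA fun i => ((T ^ n : Elt M) : H →L[ℂ] H) (x i)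
    exact ⟨mul_nonneg (by positivity) this.1, by rw [this.2, mul_zero]⟩
  bimodule A B hA hB X Y h := by
    have e : ∀ Z : Elt M, (conjSeq p T n Z : H →L[ℂ] H) = (((p n ^ 2)⁻¹ : ℝ) : ℂ) •
        (star ((T : H →L[ℂ] H) ^ n) * (Z : H →L[ℂ] H) * (T : H →L[ℂ] H) ^ n) := fun Z => by
      rw [conjSeq_apply, ← star_pow]
      rfl
    have h1 : A * (T : H →L[ℂ] H) ^ n = (T : H →L[ℂ] H) ^ n * A :=
      (Commute.pow_right (hA T hTS : Commute A (T : H →L[ℂ] H)) n)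
    have h2 : B * (T : H →L[ℂ] H) ^ n = (T : H →L[ℂ] H) ^ n * B :=
      (Commute.pow_right (hB T hTS : Commute B (T : H →L[ℂ] H)) n)
    have h3 := congrArg star h1
    rw [star_mul, star_mul] at h3
    rw [e, e, h, mul_smul_comm, smul_mul_assoc]
    congr 1
    calc star ((T : H →L[ℂ] H) ^ n) * (star A * (X : H →L[ℂ] H) * B) * (T : H →L[ℂ] H) ^ n
        = (star ((T : H →L[ℂ] H) ^ n) * star A) * (X : H →L[ℂ] H) *
          (B * (T : H →L[ℂ] H) ^ n) := by noncomm_ring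
      _ = _ := by rw [h2, h3]; noncomm_ring

end Maps

/-! ### The mean ergodic theorem for a single operator. -/

section Ergodic

variable {H : Type*} [NormedAddCommGroup H] [InnerProductSpace ℂ H] [CompleteSpace H]
variable {M : VonNeumannAlgebra H} {p : ℕ → ℝ} {c : ℝ}

/-- The map `X ↦ c⁻² T* X T`. -/
noncomputable def scaledConj (c : ℝ) (T : Elt M) : BoundedMap M :=
  (((c ^ 2)⁻¹ : ℝ) : ℂ) • ContinuousLinearMap.mulLeftRight ℂ (Elt M) (star T) T

theorem scaledConj_apply (c : ℝ) (T X : Elt M) :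
    scaledConj c T X = (((c ^ 2)⁻¹ : ℝ) : ℂ) • (star T * X * T) := by
  simp [scaledConj]

theorem scaledConj_comp_mem (c : ℝ) (T : Elt M) {l : StrongDual ℂ (Elt M)}
    (hl : l ∈ normalFunctionals M) : l.comp (scaledConj c T) ∈ normalFunctionals M := by
  rw [scaledConj, ContinuousLinearMap.comp_smul]
  exact Submodule.smul_mem _ _ (comp_mulLeftRight_mem _ _ hl)

theorem conjSeq_conj (T : Elt M) (n : ℕ) (X : Elt M) :
    conjSeq p T n (star T * X * T) =
      (((p n ^ 2)⁻¹ : ℝ) : ℂ) • (star T ^ (n + 1) * X * T ^ (n + 1)) := by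
  rw [conjSeq_apply, pow_succ (star T), pow_succ' T]
  simp only [mul_assoc]

/-- This shift identity is what lets coboundaries telescope up to weight ratios. -/
theorem conjSeq_scaledConj (hp : ∀ n, 0 < p n) (hc : 0 < c) (T : Elt M) (n : ℕ) (X : Elt M) :
    conjSeq p T n (scaledConj c T X) =
      ((gaugeWeight p c n / gaugeWeight p c (n + 1) : ℝ) : ℂ) • conjSeq p T (n + 1) X := by
  rw [scaledConj_apply, map_smul, conjSeq_conj, conjSeq_apply, smul_smul, smul_smul,
    ← Complex.ofReal_mul, ← Complex.ofReal_mul]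
  congr 2
  have h1 := (hp n).ne'
  have h2 := (hp (n + 1)).ne'
  unfold gaugeWeight
  field_simp
  ring

/-- Only `TR = RT` and its adjoint are needed; `T` need not commute with `R*`. -/
theorem conjSeq_commute {T R : Elt M} (h : T * R = R * T) (i j : ℕ) (X : Elt M) :
    conjSeq p T i (conjSeq p R j X) = conjSeq p R j (conjSeq p T i X) := by
  have h1 : T ^ i * R ^ j = R ^ j * T ^ i := Commute.pow_pow h i j
  have h2 := congrArg star h1
  rw [star_mul, star_mul, star_pow, star_pow] at h2
  simp only [conjSeq_apply, mul_smul_comm, smul_mul_assoc]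
  rw [smul_comm]
  congr 2
  calc star T ^ i * (star R ^ j * X * R ^ j) * T ^ i
      = (star T ^ i * star R ^ j) * X * (R ^ j * T ^ i) := by simp only [mul_assoc]
    _ = (star R ^ j * star T ^ i) * X * (T ^ i * R ^ j) := by rw [h1, h2]
    _ = _ := by simp only [mul_assoc]

theorem conjSeq_scaledConj_comm (T : Elt M) (n : ℕ) (X : Elt M) :
    scaledConj c T (conjSeq p T n X) = conjSeq p T n (scaledConj c T X) := by
  rw [scaledConj_apply, scaledConj_apply, map_smul, conjSeq_conj, conjSeq_apply, mul_smul_comm,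
    smul_mul_assoc, pow_succ' (star T), pow_succ T]
  simp only [mul_assoc]

/-- Asking for invariance of `f` only along the orbit of `X` covers two uses: the identity map at a
fixed point, and an invariant functional at an arbitrary point. -/
theorem pow_conj_of_scaledConj {V : Type*} [AddCommGroup V] [Module ℂ V] (hc : 0 < c)
    {T : Elt M} (f : Elt M →ₗ[ℂ] V) {X : Elt M}
    (hf : ∀ n, f (scaledConj c T (star T ^ n * X * T ^ n)) = f (star T ^ n * X * T ^ n)) (n : ℕ) :
    f (star T ^ n * X * T ^ n) = ((c ^ n : ℝ) : ℂ) ^ 2 • f X := by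
  induction n with
  | zero => simp
  | succ n ih =>
    have h := hf n
    rw [scaledConj_apply, map_smul] at h
    have e : star T ^ (n + 1) * X * T ^ (n + 1) = star T * (star T ^ n * X * T ^ n) * T := by
      rw [pow_succ' (star T), pow_succ T]
      simp only [mul_assoc]
    have hc2 : ((c ^ 2 : ℝ) : ℂ) ≠ 0 := Complex.ofReal_ne_zero.2 (by positivity)
    rw [Complex.ofReal_inv, inv_smul_eq_iff₀ hc2, ih, smul_smul] at h
    rw [e, h]
    congr 1
    push_cast
    ring

theorem map_conjSeq_of_invariant {V : Type*} [AddCommGroup V] [Module ℂ V] (hc : 0 < c)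
    {T : Elt M} (f : Elt M →ₗ[ℂ] V) {X : Elt M}
    (hf : ∀ n, f (scaledConj c T (star T ^ n * X * T ^ n)) = f (star T ^ n * X * T ^ n)) (n : ℕ) :
    f (conjSeq p T n X) = ((gaugeWeight p c n : ℝ) : ℂ) • f X := by
  rw [conjSeq_apply, map_smul, pow_conj_of_scaledConj hc f hf, smul_smul]
  congr 1
  unfold gaugeWeight
  push_cast
  rw [div_pow, mul_comm]
  rfl

/-- If `f` turns the maps `X ↦ p(n)⁻² T*ⁿ X Tⁿ` into the gauge weights, then it is nearly unchanged by
long averages of these maps. -/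
theorem averageMap_of_weights (hp : IsRegularGauge p c) {T : Elt M} {V : Type*}
    [NormedAddCommGroup V] [NormedSpace ℂ V] (f : Elt M →ₗ[ℂ] V) {X : Elt M}
    (hf : ∀ n, f (conjSeq p T n X) = ((gaugeWeight p c n : ℝ) : ℂ) • f X)
    {ε : ℝ} (hε : 0 < ε) :
    ∃ N : ℕ, ∀ n ≥ N, ∀ k, ‖f (averageMap (conjSeq p T) k n X) - f X‖ ≤ ε := by
  obtain ⟨N, hN⟩ := hp.uniformlyAverageZero_weight (ε / (‖f X‖ + 1)) (by positivity)
  refine ⟨N, fun n hn k => ?_⟩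
  have e : f (averageMap (conjSeq p T) k n X) - f X = ((n : ℂ) + 1)⁻¹ •
      ∑ i ∈ Finset.range (n + 1), ((gaugeWeight p c (k + i) - 1 : ℝ) : ℂ) • f X := by
    rw [map_averageMap]
    conv_lhs => rw [← average_const (f X) n]
    rw [← smul_sub, ← Finset.sum_sub_distrib]
    congr 1
    refine Finset.sum_congr rfl fun i _ => ?_
    rw [hf]
    push_cast
    rw [sub_smul, one_smul]
  rw [e]
  refine norm_average_le_sum _ n ?_
  simp only [norm_smul, Complex.norm_real, Real.norm_eq_abs]
  rw [← Finset.sum_mul]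
  calc (∑ i ∈ Finset.range (n + 1), |gaugeWeight p c (k + i) - 1|) * ‖f X‖
      ≤ (ε / (‖f X‖ + 1) * (n + 1)) * (‖f X‖ + 1) := by
        gcongr
        · exact hN n hn k
        · linarith
    _ = ε * (n + 1) := by field_simp

/-- Averages of `X - c⁻² T* X T` tend to zero, uniformly. -/
theorem averageMap_coboundary (hp : IsRegularGauge p c) {T : Elt M} {V : Type*}
    [NormedAddCommGroup V] [NormedSpace ℂ V] (f : Elt M →ₗ[ℂ] V) {X : Elt M} {C : ℝ}
    (hf : ∀ n, ‖f (conjSeq p T (n + 1) X)‖ ≤ C) {ε : ℝ} (hε : 0 < ε) :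
    ∃ N : ℕ, ∀ n ≥ N, ∀ k,
      ‖f (averageMap (conjSeq p T) (k + 1) n (X - scaledConj c T X))‖ ≤ ε := by
  have hC : 0 ≤ C := (norm_nonneg _).trans (hf 0)
  obtain ⟨N, hN⟩ := hp.uniformlyAverageZero_ratio (ε / (2 * (C + 1))) (by positivity)
  obtain ⟨N', hN'⟩ := exists_nat_gt (2 * C / (ε / 2))
  refine ⟨max N N', fun n hn k => ?_⟩
  let a : ℕ → V := fun i => f (conjSeq p T (k + 1 + i) X)
  have ha : ∀ i, ‖a i‖ ≤ C := fun i => by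
    have := hf (k + i)
    rwa [show k + i + 1 = k + 1 + i by ring] at this
  -- With `b` the deviation of the weight ratio from `1`, the `i`-th term is `a i - (1 + b i) a (i +
  -- 1)`: a telescoping part plus an error that is small on average.
  let b : ℕ → ℝ := fun i =>
    gaugeWeight p c (k + 1 + i) / gaugeWeight p c (k + 1 + i + 1) - 1
  have e : f (averageMap (conjSeq p T) (k + 1) n (X - scaledConj c T X)) = ((n : ℂ) + 1)⁻¹ •
      ((a 0 - a (n + 1)) - ∑ i ∈ Finset.range (n + 1), ((b i : ℝ) : ℂ) • a (i + 1)) := by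
    rw [map_averageMap]
    congr 1
    rw [← Finset.sum_range_sub', ← Finset.sum_sub_distrib]
    refine Finset.sum_congr rfl fun i _ => ?_
    rw [map_sub, map_sub, conjSeq_scaledConj hp.1.1 hp.1.2.1, map_smul]
    simp only [a, b]
    push_cast
    rw [sub_smul, one_smul, ← add_assoc]
    abel
  rw [e, norm_smul, norm_inv, norm_natCast_add_one, inv_mul_le_iff₀ (by positivity)]
  have h1 : ‖a 0 - a (n + 1)‖ ≤ 2 * C := by
    have := (norm_sub_le (a 0) (a (n + 1))).trans (add_le_add (ha _) (ha _))
    linarith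
  have h2 : ‖∑ i ∈ Finset.range (n + 1), ((b i : ℝ) : ℂ) • a (i + 1)‖ ≤
      ε / 2 * (n + 1) := by
    refine (norm_sum_le _ _).trans ?_
    calc ∑ i ∈ Finset.range (n + 1), ‖((b i : ℝ) : ℂ) • a (i + 1)‖
        ≤ ∑ i ∈ Finset.range (n + 1), |b i| * (C + 1) := by
          refine Finset.sum_le_sum fun i _ => ?_
          rw [norm_smul, Complex.norm_real, Real.norm_eq_abs]
          gcongr
          exact (ha _).trans (by linarith)
      _ = (∑ i ∈ Finset.range (n + 1), |b i|) * (C + 1) := by rw [Finset.sum_mul]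
      _ ≤ ε / (2 * (C + 1)) * (n + 1) * (C + 1) := by
          gcongr
          exact hN n ((le_max_left _ _).trans hn) (k + 1)
      _ = ε / 2 * (n + 1) := by field_simp
  have h3 : 2 * C ≤ ε / 2 * (n + 1) := by
    have h4 : (N' : ℝ) ≤ n := by exact_mod_cast (le_max_right _ _).trans hn
    have h5 := (div_lt_iff₀ (by positivity)).1 hN'
    nlinarith
  have := norm_sub_le (a 0 - a (n + 1))
    (∑ i ∈ Finset.range (n + 1), ((b i : ℝ) : ℂ) • a (i + 1))
  linarith

/-- `E` is an ultraweak limit of averages of the maps `X ↦ p(n)⁻² T*ⁿ X Tⁿ`. -/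
def IsErgodicLimit (p : ℕ → ℝ) (T : Elt M) (U : Ultrafilter ℕ) (E : BoundedMap M) : Prop :=
  ∀ l ∈ normalFunctionals M, ∀ X,
    Tendsto (fun n => l (averageMap (conjSeq p T) 1 n X)) U (𝓝 (l (E X)))

section Limit

variable {T : Elt M} {E : BoundedMap M} {U : Ultrafilter ℕ}

theorem norm_conjSeq_le (hp : ∀ n, 0 < p n) (hT : IsDominatedBy T p) {n : ℕ} (hn : 1 ≤ n)
    (X : Elt M) : ‖conjSeq p T n X‖ ≤ ‖X‖ := by
  rw [conjSeq_apply]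
  refine norm_smul_conj_le hp hT hn (norm_nonneg _) ((norm_mul_le _ _).trans ?_)
  rw [mul_comm]
  gcongr
  refine (norm_mul_le _ _).trans ?_
  rw [← star_pow, norm_star]

theorem isAdmissible_average {S : Set (Elt M)} (hp : ∀ n, 0 < p n) (hTS : T ∈ S)
    (hT : IsDominatedBy T p) (k n : ℕ) :
    IsAdmissible S (averageMap (conjSeq p T) (k + 1) n) :=
  IsAdmissible.average (fun i => isAdmissible_conjSeq hp hTS hT (by omega)) n

theorem tendsto_of_eventually_norm_le {g : ℕ → ℂ} (hU : (U : Filter ℕ) ≤ atTop) {z : ℂ}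
    (h : ∀ ε : ℝ, 0 < ε → ∃ N : ℕ, ∀ n ≥ N, ‖g n - z‖ ≤ ε) : Tendsto g U (𝓝 z) := by
  refine Tendsto.mono_left (Metric.tendsto_atTop.2 fun ε hε => ?_) hU
  obtain ⟨N, hN⟩ := h (ε / 2) (by positivity)
  exact ⟨N, fun n hn => by rw [dist_eq_norm]; linarith [hN n hn]⟩

theorem IsErgodicLimit.apply_scaledConj (hE : IsErgodicLimit p T U E)
    (hU : (U : Filter ℕ) ≤ atTop) (hp : IsRegularGauge p c) (hT : IsDominatedBy T p) (X : Elt M) :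
    E (scaledConj c T X) = E X := by
  refine ext_normal fun l hl => ?_
  have h1 : Tendsto (fun n => l (averageMap (conjSeq p T) 1 n (X - scaledConj c T X))) U
      (𝓝 0) := by
    refine tendsto_of_eventually_norm_le hU fun ε hε => ?_
    obtain ⟨N, hN⟩ := averageMap_coboundary hp (T := T) l.toLinearMap (X := X) (C := ‖l‖ * ‖X‖)
      (fun n => l.le_opNorm_of_le (norm_conjSeq_le hp.1.1 hT (by omega) X)) hε
    exact ⟨N, fun n hn => by rw [sub_zero]; exact hN n hn 0⟩
  have h2 := tendsto_nhds_unique (hE l hl (X - scaledConj c T X)) h1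
  rw [map_sub, map_sub, sub_eq_zero] at h2
  exact h2.symm

/-- `Θ` is normal and commutes with the averages, so `ΘE` and `EΘ` are the same limit; and `EΘ = E`
because the averages kill coboundaries. -/
theorem IsErgodicLimit.scaledConj_apply (hE : IsErgodicLimit p T U E)
    (hU : (U : Filter ℕ) ≤ atTop) (hp : IsRegularGauge p c) (hT : IsDominatedBy T p) (X : Elt M) :
    scaledConj c T (E X) = E X := by
  refine ext_normal fun l hl => ?_
  have h1 := hE _ (scaledConj_comp_mem c T hl) X
  have h2 := hE l hl (scaledConj c T X)
  rw [hE.apply_scaledConj hU hp hT] at h2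
  refine tendsto_nhds_unique h1 (h2.congr fun n => ?_)
  simp only [ContinuousLinearMap.comp_apply, averageMap_apply, map_smul, map_sum,
    conjSeq_scaledConj_comm]

theorem conjSeq_of_fixed (hc : 0 < c) {Y : Elt M} (hY : scaledConj c T Y = Y) (n : ℕ) :
    conjSeq p T n Y = ((gaugeWeight p c n : ℝ) : ℂ) • Y := by
  refine map_conjSeq_of_invariant hc LinearMap.id (fun n => ?_) n
  have e : scaledConj c T (star T ^ n * Y * T ^ n) =
      star T ^ n * scaledConj c T Y * T ^ n := by
    rw [FiniteVN.scaledConj_apply, FiniteVN.scaledConj_apply, mul_smul_comm, smul_mul_assoc]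
    congr 1
    calc star T * (star T ^ n * Y * T ^ n) * T = (star T * star T ^ n) * Y * (T ^ n * T) := by
          simp only [mul_assoc]
      _ = (star T ^ n * star T) * Y * (T * T ^ n) := by
          rw [← pow_succ', ← pow_succ, ← pow_succ, ← pow_succ']
      _ = _ := by simp only [mul_assoc]
  rw [LinearMap.id_apply, LinearMap.id_apply, e, hY]

theorem IsErgodicLimit.apply_fixed (hE : IsErgodicLimit p T U E)
    (hU : (U : Filter ℕ) ≤ atTop) (hp : IsRegularGauge p c) {Y : Elt M}
    (hY : scaledConj c T Y = Y) : E Y = Y := by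
  refine ext_normal fun l hl => tendsto_nhds_unique (hE l hl Y) ?_
  refine tendsto_of_eventually_norm_le hU fun ε hε => ?_
  obtain ⟨N, hN⟩ := averageMap_of_weights hp (T := T) (X := Y) l.toLinearMap
    (fun n => by rw [conjSeq_of_fixed hp.1.2.1 hY, map_smul]) hε
  exact ⟨N, fun n hn => hN n hn 1⟩

theorem IsErgodicLimit.isIdempotentElem (hE : IsErgodicLimit p T U E)
    (hU : (U : Filter ℕ) ≤ atTop) (hp : IsRegularGauge p c) (hT : IsDominatedBy T p) :
    IsIdempotentElem E := by
  ext1 X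
  exact hE.apply_fixed hU hp (hE.scaledConj_apply hU hp hT X)

variable {τ : Elt M →ₗ[ℂ] ℂ} (hτ : IsFaithfulNormalTrace τ)

/-- Mean ergodic decomposition by double orthogonals: for `v` orthogonal to the coboundaries, `⟨v,
·⟩` is `Θ`-invariant, so its values on the averages of `X` tend to its value at `X`. They also tend
to its value at `E X`. -/
theorem IsErgodicLimit.sub_mem_closure (hE : IsErgodicLimit p T U E)
    (hU : (U : Filter ℕ) ≤ atTop) (hp : IsRegularGauge p c) (hT : IsDominatedBy T p)
    (hEn : ‖E‖ ≤ 1) (X : Elt M) :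
    toL2 hτ (X - E X) ∈ closure (Set.range fun Y => toL2 hτ (Y - scaledConj c T Y)) := by
  let D : Submodule ℂ (L2 hτ) :=
    (toL2 hτ ∘ₗ (LinearMap.id - (scaledConj c T).toLinearMap)).range
  have hD : (D : Set (L2 hτ)) = Set.range fun Y => toL2 hτ (Y - scaledConj c T Y) := by
    ext; rfl
  rw [← hD]
  change toL2 hτ (X - E X) ∈ D.topologicalClosure
  rw [← Submodule.orthogonal_orthogonal_eq_closure, Submodule.mem_orthogonal]
  intro v hv
  let f : Elt M →ₗ[ℂ] ℂ := (innerSL ℂ v).toLinearMap ∘ₗ toL2 hτ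
  have hf : ∀ Y, f (scaledConj c T Y) = f Y := fun Y => by
    have h := (Submodule.mem_orthogonal' D v).1 hv _ ⟨Y, rfl⟩
    have h' : f (Y - scaledConj c T Y) = 0 := h
    rw [map_sub, sub_eq_zero] at h'
    exact h'.symm
  have h1 : Tendsto (fun n => f (averageMap (conjSeq p T) 1 n X)) U (𝓝 (f X)) := by
    refine tendsto_of_eventually_norm_le hU fun ε hε => ?_
    obtain ⟨N, hN⟩ := averageMap_of_weights hp (T := T) (X := X) f
      (map_conjSeq_of_invariant hp.1.2.1 f fun n => hf _) hε
    exact ⟨N, fun n hn => hN n hn 1⟩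
  have hA : ∀ n, ‖averageMap (conjSeq p T) 1 n X‖ ≤ ‖X‖ := fun n => by
    rw [averageMap_apply]
    exact norm_average_le n fun i => norm_conjSeq_le hp.1.1 hT (by omega) X
  have hEX : ‖E X‖ ≤ ‖X‖ := (E.le_of_opNorm_le hEn X).trans_eq (one_mul _)
  have h2 : Tendsto (fun n => f (averageMap (conjSeq p T) 1 n X)) U (𝓝 (f (E X))) := by
    rw [Metric.tendsto_nhds]
    intro ε hε
    have hK : 0 < 4 * (‖toL2 hτ 1‖ * ‖X‖ + 1) := by positivity
    -- Ultraweak convergence only tests against vectors from `M`; boundedness of the averages lets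
    -- such a vector replace `v` at a cost of `ε / 2`.
    obtain ⟨Y, hY⟩ := (denseRange_toL2 hτ).exists_dist_lt v (div_pos hε hK)
    have h3 := hE _ (traceFunctional_mem hτ (star Y)) X
    simp only [traceFunctional_apply, ← inner_toL2 hτ] at h3
    filter_upwards [Metric.tendsto_nhds.1 h3 (ε / 2) (by positivity)] with n hn
    rw [dist_eq_norm] at hn hY ⊢
    have e : f (averageMap (conjSeq p T) 1 n X) - f (E X) =
        (inner ℂ (toL2 hτ Y) (toL2 hτ (averageMap (conjSeq p T) 1 n X)) -
          inner ℂ (toL2 hτ Y) (toL2 hτ (E X))) +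
        inner ℂ (v - toL2 hτ Y) (toL2 hτ (averageMap (conjSeq p T) 1 n X - E X)) := by
      simp only [f, LinearMap.comp_apply, ContinuousLinearMap.coe_coe, innerSL_apply_apply,
        map_sub, inner_sub_left, inner_sub_right]
      ring
    have h4 : ‖(inner ℂ (v - toL2 hτ Y)
        (toL2 hτ (averageMap (conjSeq p T) 1 n X - E X)) : ℂ)‖ ≤ ε / 2 := by
      refine (norm_inner_le_norm _ _).trans ?_
      have h5 : ‖toL2 hτ (averageMap (conjSeq p T) 1 n X - E X)‖ ≤
          2 * (‖toL2 hτ 1‖ * ‖X‖ + 1) := by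
        refine (norm_toL2_le hτ _).trans ?_
        have h6 : ‖averageMap (conjSeq p T) 1 n X - E X‖ ≤ 2 * ‖X‖ := by
          have := norm_sub_le (averageMap (conjSeq p T) 1 n X) (E X)
          linarith [hA n]
        calc _ ≤ ‖toL2 hτ 1‖ * (2 * ‖X‖) := by gcongr
          _ ≤ _ := by linarith
      calc _ ≤ ε / (4 * (‖toL2 hτ 1‖ * ‖X‖ + 1)) * (2 * (‖toL2 hτ 1‖ * ‖X‖ + 1)) := by
            gcongr
        _ = ε / 2 := by field_simp; norm_num
    rw [e]
    have := norm_add_le (inner ℂ (toL2 hτ Y) (toL2 hτ (averageMap (conjSeq p T) 1 n X)) -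
          inner ℂ (toL2 hτ Y) (toL2 hτ (E X)) : ℂ)
      (inner ℂ (v - toL2 hτ Y) (toL2 hτ (averageMap (conjSeq p T) 1 n X - E X)))
    linarith
  change inner ℂ v (toL2 hτ (X - E X)) = 0
  rw [map_sub, inner_sub_right, sub_eq_zero]
  exact tendsto_nhds_unique h1 h2

/-- The averages converge in the norm of `L²(M, τ)`, uniformly in the position. -/
theorem IsErgodicLimit.uniform_toL2 (hE : IsErgodicLimit p T U E)
    (hU : (U : Filter ℕ) ≤ atTop) (hp : IsRegularGauge p c) (hT : IsDominatedBy T p)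
    (hEn : ‖E‖ ≤ 1) (X : Elt M) {ε : ℝ} (hε : 0 < ε) :
    ∃ N : ℕ, ∀ n ≥ N, ∀ k,
      ‖toL2 hτ (averageMap (conjSeq p T) (k + 1) n X - E X)‖ ≤ ε := by
  -- Write `X` as `E X`, a coboundary `Y - ΘY` and an `L²`-small rest. The averages nearly fix the
  -- first, nearly kill the second and contract the third, at `ε / 3` each.
  obtain ⟨_, ⟨Y, rfl⟩, hY⟩ := Metric.mem_closure_iff.1
    (hE.sub_mem_closure hτ hU hp hT hEn X) (ε / 3) (by positivity)
  have adm : ∀ k n, IsAdmissible {T} (averageMap (conjSeq p T) (k + 1) n) := fun k n =>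
    isAdmissible_average hp.1.1 (Set.mem_singleton T) hT k n
  obtain ⟨N₁, hN₁⟩ := averageMap_of_weights hp (T := T) (X := E X) (toL2 hτ)
    (fun n => by rw [conjSeq_of_fixed hp.1.2.1 (hE.scaledConj_apply hU hp hT X), map_smul])
    (ε := ε / 3) (by positivity)
  obtain ⟨N₂, hN₂⟩ := averageMap_coboundary hp (T := T) (toL2 hτ) (X := Y) (C := ‖toL2 hτ Y‖)
    (fun n => (isAdmissible_conjSeq hp.1.1 (Set.mem_singleton T) hT (by omega)).norm_toL2_le
      τ hτ Y) (ε := ε / 3) (by positivity)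
  refine ⟨max N₁ N₂, fun n hn k => ?_⟩
  have h1 := hN₁ n ((le_max_left _ _).trans hn) (k + 1)
  have h2 := hN₂ n ((le_max_right _ _).trans hn) k
  have h3 := (adm k n).norm_toL2_le τ hτ ((X - E X) - (Y - scaledConj c T Y))
  rw [map_sub (toL2 hτ) (X - E X), ← dist_eq_norm] at h3
  have h4 := h3.trans hY.le
  set A := averageMap (conjSeq p T) (k + 1) n
  have e : toL2 hτ (A X - E X) = (toL2 hτ (A (E X)) - toL2 hτ (E X)) +
      (toL2 hτ (A (Y - scaledConj c T Y)) +
        toL2 hτ (A ((X - E X) - (Y - scaledConj c T Y)))) := by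
    simp only [map_sub]
    abel
  rw [e]
  refine (norm_add_le _ _).trans ?_
  have := norm_add_le (toL2 hτ (A (Y - scaledConj c T Y)))
    (toL2 hτ (A ((X - E X) - (Y - scaledConj c T Y))))
  linarith

theorem IsErgodicLimit.isAdmissible {S : Set (Elt M)} (hTS : T ∈ S)
    (hE : IsErgodicLimit p T U E) (hp : ∀ n, 0 < p n) (hT : IsDominatedBy T p) (hEn : ‖E‖ ≤ 1) :
    IsAdmissible S E :=
  IsAdmissible.of_tendsto U (fun n => isAdmissible_average hp hTS hT 0 n) hEn hE

include hτ in
theorem IsErgodicLimit.weaklyAlmostConvergesTo (hE : IsErgodicLimit p T U E)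
    (hU : (U : Filter ℕ) ≤ atTop) (hp : IsRegularGauge p c) (hT : IsDominatedBy T p)
    (hEn : ‖E‖ ≤ 1) : WeaklyAlmostConvergesTo (conjSeq p T) E := by
  have adm : IsAdmissible {T} E :=
    hE.isAdmissible (Set.mem_singleton T) hp.1.1 hT hEn
  refine ⟨((adm.contractive τ hτ).isStableFor hτ).1, fun l hl X => ?_⟩
  obtain ⟨f, hf, hfl⟩ := exists_normal_of_mem_predual hl
  have hEX : ‖E X‖ ≤ ‖X‖ := (E.le_of_opNorm_le hEn X).trans_eq (one_mul _)
  simp only [← hfl]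
  -- Domination says nothing at `n = 0`; that term enters only the bound, and the windows start at
  -- `k + 1`.
  refine almostConvergesTo_zero_of_shift (C := ‖f‖ * (‖conjSeq p T 0 X‖ + ‖X‖ + ‖X‖))
    (fun n => f.le_opNorm_of_le ?_) fun ε hε => ?_
  · have h1 := norm_sub_le (conjSeq p T n X) (E X)
    rcases Nat.eq_zero_or_pos n with rfl | hn
    · linarith [norm_nonneg X]
    · linarith [norm_conjSeq_le hp.1.1 hT hn X, norm_nonneg (conjSeq p T 0 X)]
  · obtain ⟨δ, hδ, h⟩ := exists_delta_of_normal hτ hf (R := 2 * ‖X‖) (by positivity) hε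
    obtain ⟨N, hN⟩ := hE.uniform_toL2 hτ hU hp hT hEn X hδ
    refine ⟨N, fun n hn k => ?_⟩
    have e : f (averageMap (conjSeq p T) (k + 1) n X - E X) = ((n : ℂ) + 1)⁻¹ *
        ∑ i ∈ Finset.range (n + 1), f (conjSeq p T (k + 1 + i) X - E X) := by
      conv_lhs => rw [averageMap_apply, ← average_const (E X) n, ← smul_sub,
        ← Finset.sum_sub_distrib, map_smul, map_sum, smul_eq_mul]
    rw [← e]
    refine (h _ ?_ (hN n hn k)).le
    have h1 := norm_sub_le (averageMap (conjSeq p T) (k + 1) n X) (E X)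
    have h2 : ‖averageMap (conjSeq p T) (k + 1) n X‖ ≤ ‖X‖ := by
      rw [averageMap_apply]
      exact norm_average_le n fun i => norm_conjSeq_le hp.1.1 hT (by omega) X
    linarith

end Limit

end Ergodic

/-! ### Commuting limits and convergence of the net of projections. -/

section Net

variable {H : Type*} [NormedAddCommGroup H] [InnerProductSpace ℂ H] [CompleteSpace H]
variable {M : VonNeumannAlgebra H} {p : ℕ → ℝ} {c : ℝ}

theorem averageMap_commute {φ ψ : ℕ → BoundedMap M}
    (h : ∀ i j X, φ i (ψ j X) = ψ j (φ i X)) (k n k' n' : ℕ) (X : Elt M) :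
    averageMap φ k n (averageMap ψ k' n' X) = averageMap ψ k' n' (averageMap φ k n X) := by
  simp only [averageMap_apply, map_smul, map_sum, h, ← Finset.smul_sum]
  rw [smul_comm, Finset.sum_comm]

/-- Ultraweak limits of commuting families of normal maps commute. -/
theorem commute_of_tendsto {ι κ : Type*} {U : Ultrafilter ι} {V : Ultrafilter κ}
    {φ : ι → BoundedMap M} {ψ : κ → BoundedMap M} {E F : BoundedMap M}
    (hE : ∀ l ∈ normalFunctionals M, ∀ X, Tendsto (fun i => l (φ i X)) U (𝓝 (l (E X))))
    (hF : ∀ l ∈ normalFunctionals M, ∀ X, Tendsto (fun j => l (ψ j X)) V (𝓝 (l (F X))))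
    (hφ : ∀ i, ∀ l ∈ normalFunctionals M, l.comp (φ i) ∈ normalFunctionals M)
    (hFn : ∀ l ∈ normalFunctionals M, l.comp F ∈ normalFunctionals M)
    (h : ∀ i j X, φ i (ψ j X) = ψ j (φ i X)) : E * F = F * E := by
  -- The limits are taken one at a time: the inner one needs `φ i` to be normal, the outer one needs
  -- `F` to be.
  have h1 : ∀ i X, φ i (F X) = F (φ i X) := fun i X => ext_normal fun l hl =>
    tendsto_nhds_unique (hF _ (hφ i l hl) X)
      ((hF l hl (φ i X)).congr fun j => by rw [ContinuousLinearMap.comp_apply, h])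
  ext1 X
  refine ext_normal fun l hl => tendsto_nhds_unique (hE l hl (F X)) ?_
  refine (hE _ (hFn l hl) X).congr fun i => ?_
  rw [ContinuousLinearMap.comp_apply, h1]

/-- A contractive idempotent on an inner product space is orthogonal. -/
theorem norm_sub_sq_of_contractive {V : Type*} [NormedAddCommGroup V] [InnerProductSpace ℂ V]
    {x y : V} (h : ∀ a : ℂ, ‖y‖ ≤ ‖y + a • (x - y)‖) : ‖x - y‖ ^ 2 = ‖x‖ ^ 2 - ‖y‖ ^ 2 := by
  have h0 : inner ℂ (x - y) y = (0 : ℂ) := by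
    rcases eq_or_ne (x - y) 0 with hz | hz
    · rw [hz, inner_zero_left]
    have hpos : 0 < ‖x - y‖ ^ 2 := by positivity
    set z := x - y
    set w : ℂ := inner ℂ z y
    -- This scalar minimizes `‖y + a z‖`, lowering its square by `|w|² / ‖z‖²`; so `w = 0`.
    have h1 := h (-(w / ((‖z‖ ^ 2 : ℝ) : ℂ)))
    have h2 : ‖y‖ ^ 2 ≤ ‖y + -(w / ((‖z‖ ^ 2 : ℝ) : ℂ)) • z‖ ^ 2 := by gcongr
    rw [@norm_add_sq ℂ, norm_smul, norm_neg, norm_div, Complex.norm_real,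
      Real.norm_of_nonneg hpos.le, inner_smul_right] at h2
    have e1 : (inner ℂ y z : ℂ) = star w := (inner_conj_symm _ _).symm
    have e2 : RCLike.re (-(w / ((‖z‖ ^ 2 : ℝ) : ℂ)) * inner ℂ y z : ℂ) =
        -(‖w‖ ^ 2 / ‖z‖ ^ 2) := by
      have : -(w / ((‖z‖ ^ 2 : ℝ) : ℂ)) * inner ℂ y z =
          ((-(‖w‖ ^ 2 / ‖z‖ ^ 2) : ℝ) : ℂ) := by
        rw [e1, neg_mul, div_mul_eq_mul_div, RCLike.star_def, Complex.mul_conj,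
          Complex.normSq_eq_norm_sq]
        push_cast
        rfl
      rw [this]
      exact Complex.ofReal_re _
    rw [e2] at h2
    have e3 : (‖w‖ / ‖z‖ ^ 2 * ‖z‖) ^ 2 = ‖w‖ ^ 2 / ‖z‖ ^ 2 := by
      have : ‖z‖ ≠ 0 := norm_ne_zero_iff.2 hz
      field_simp
    rw [e3] at h2
    have h3 : ‖w‖ ^ 2 / ‖z‖ ^ 2 ≤ 0 := by linarith
    have h4 : ‖w‖ ^ 2 ≤ 0 := by
      by_contra! hw
      exact absurd (div_pos hw hpos) (not_lt.2 h3)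
    exact norm_eq_zero.1 (pow_eq_zero_iff two_ne_zero |>.1 (le_antisymm h4 (sq_nonneg _)))
  have h5 : ‖x‖ ^ 2 = ‖(x - y) + y‖ ^ 2 := by rw [sub_add_cancel]
  rw [@norm_add_sq ℂ, h0] at h5
  simp only [map_zero, mul_zero, add_zero] at h5
  linarith

variable {τ : Elt M →ₗ[ℂ] ℂ} (hτ : IsFaithfulNormalTrace τ) {S : Set (Elt M)}

/-- `F` sends every point `F X + a (X - F X)` to `F X`, so contractivity makes `F X` the shortest
vector on this complex line. -/
theorem IsAdmissible.norm_toL2_sub_sq {F : BoundedMap M} (hF : IsAdmissible S F)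
    (hi : IsIdempotentElem F) (X : Elt M) :
    ‖toL2 hτ X - toL2 hτ (F X)‖ ^ 2 = ‖toL2 hτ X‖ ^ 2 - ‖toL2 hτ (F X)‖ ^ 2 := by
  refine norm_sub_sq_of_contractive fun a => ?_
  have h := hF.norm_toL2_le τ hτ (F X + a • (X - F X))
  have hFF : F (F X) = F X := congrArg (fun G : BoundedMap M => G X) hi
  rw [map_add F, map_smul F, map_sub F, hFF, sub_self, smul_zero, add_zero] at h
  simpa only [map_add, map_smul, map_sub] using h

variable {𝓔 : Subsemigroup (BoundedMap M)}

/-- A commutative semigroup of admissible idempotents, as a net, is Cauchy in the norm of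
`L²(M, τ)`. -/
theorem exists_small_tail (hadm : ∀ F ∈ 𝓔, IsAdmissible S F)
    (hidem : ∀ F ∈ 𝓔, IsIdempotentElem F) (hne : ∃ F, F ∈ 𝓔) (X : Elt M) {δ : ℝ} (hδ : 0 < δ) :
    ∃ F₀ ∈ 𝓔, ∀ F ∈ 𝓔, NetLE 𝓔 F₀ F → ‖toL2 hτ (F₀ X - F X)‖ ≤ δ := by
  let A : Set ℝ := (fun F : BoundedMap M => ‖toL2 hτ (F X)‖ ^ 2) '' (𝓔 : Set (BoundedMap M))
  have hA : A.Nonempty := hne.elim fun F hF => ⟨_, F, hF, rfl⟩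
  have hb : BddBelow A := ⟨0, by rintro _ ⟨F, -, rfl⟩; positivity⟩
  -- `F₀` nearly minimizes `‖F X‖₂²`. Pythagoras for `F'` at `F₀ X` then bounds the squared distance
  -- to any later `F X` by `δ²`.
  obtain ⟨_, ⟨F₀, hF₀, rfl⟩, hlt⟩ := Real.lt_sInf_add_pos hA (pow_pos hδ 2)
  refine ⟨F₀, hF₀, fun F hF ⟨F', hF', e⟩ => ?_⟩
  have h1 := (hadm F' hF').norm_toL2_sub_sq hτ (hidem F' hF') (F₀ X)
  have h2 : F' (F₀ X) = F X := by rw [e]; rfl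
  rw [h2, ← map_sub] at h1
  have h3 : sInf A ≤ ‖toL2 hτ (F X)‖ ^ 2 := csInf_le hb ⟨F, hF, rfl⟩
  refine (pow_le_pow_iff_left₀ (norm_nonneg _) hδ.le two_ne_zero).1 ?_
  rw [h1]
  simp only at hlt
  linarith

/-- The filter of tails of the net `𝓔`. -/
def tailFilter (𝓔 : Subsemigroup (BoundedMap M)) : Filter 𝓔 :=
  ⨅ F₀ : 𝓔, 𝓟 {F : 𝓔 | NetLE 𝓔 F₀ F}

theorem tail_mem (F₀ : 𝓔) : {F : 𝓔 | NetLE 𝓔 F₀ F} ∈ tailFilter 𝓔 :=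
  mem_iInf_of_mem F₀ (mem_principal_self _)

/-- Commutativity directs the semigroup: everything after `F * G` comes after both `F` and `G`. -/
theorem tailFilter_neBot (hne : ∃ F, F ∈ 𝓔) (hcomm : ∀ F ∈ 𝓔, ∀ G ∈ 𝓔, F * G = G * F) :
    (tailFilter 𝓔).NeBot := by
  have : Nonempty 𝓔 := hne.elim fun F hF => ⟨⟨F, hF⟩⟩
  refine iInf_neBot_of_directed' (fun F G => ⟨F * G, ?_, ?_⟩) fun F => ?_
  · refine principal_mono.2 fun K hK => ?_
    obtain ⟨L, hL, e⟩ := hK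
    exact ⟨L * G, mul_mem hL G.2, by
      rw [e, MulMemClass.coe_mul, hcomm F F.2 G G.2, mul_assoc]⟩
  · refine principal_mono.2 fun K hK => ?_
    obtain ⟨L, hL, e⟩ := hK
    exact ⟨L * F, mul_mem hL F.2, by rw [e, MulMemClass.coe_mul, mul_assoc]⟩
  · exact principal_neBot_iff.2 ⟨F * F, F, F.2, rfl⟩

include hτ in
/-- A commutative semigroup of admissible idempotents, as a net, converges to an admissible
idempotent that absorbs it. -/
theorem exists_net_limit (hadm : ∀ F ∈ 𝓔, IsAdmissible S F)
    (hidem : ∀ F ∈ 𝓔, IsIdempotentElem F) (hne : ∃ F, F ∈ 𝓔)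
    (hcomm : ∀ F ∈ 𝓔, ∀ G ∈ 𝓔, F * G = G * F) :
    ∃ E : BoundedMap M, IsAdmissible S E ∧ NetConvergesWeaklyTo 𝓔 E ∧ IsIdempotentElem E ∧
      ∀ F ∈ 𝓔, E * F = E := by
  have := tailFilter_neBot hne hcomm
  let U := Ultrafilter.of (tailFilter 𝓔)
  have hU : (U : Filter 𝓔) ≤ tailFilter 𝓔 := Ultrafilter.of_le _
  have hn : ∀ F ∈ 𝓔, ‖F‖ ≤ 1 := fun F hF => ((hadm F hF).contractive τ hτ).norm_le
  obtain ⟨E, hE, hlim⟩ := exists_map_limit U (fun F : 𝓔 => (F : BoundedMap M))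
    fun F => hn F F.2
  have hEadm : IsAdmissible S E := IsAdmissible.of_tendsto U (fun F : 𝓔 => hadm F F.2) hE hlim
  -- Every `G = K F` in the tail of `F` already satisfies `G F = G`, since `F` is idempotent.
  have habs : ∀ F ∈ 𝓔, E * F = E := fun F hF => by
    ext1 X
    refine ext_normal fun l hl => tendsto_nhds_unique (hlim l hl (F X)) ?_
    refine (hlim l hl X).congr' ?_
    filter_upwards [hU (tail_mem ⟨F, hF⟩)] with G hG
    obtain ⟨K, hK, e⟩ := hG
    have h1 : (G : BoundedMap M) * F = G := by
      rw [e, mul_assoc, (hidem F hF : F * F = F)]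
    change l ((G : BoundedMap M) X) = l (((G : BoundedMap M) * F) X)
    rw [h1]
  refine ⟨E, hEadm, fun l hl X ε hε => ?_, ?_, habs⟩
  · obtain ⟨f, hf, hfl⟩ := exists_normal_of_mem_predual hl
    obtain ⟨δ, hδ, h⟩ := exists_delta_of_normal hτ hf (R := 2 * ‖X‖) (by positivity)
      (half_pos hε)
    obtain ⟨F₀, hF₀, hF⟩ := exists_small_tail hτ hadm hidem hne X (half_pos hδ)
    refine ⟨F₀, hF₀, fun F hF𝓔 hle => ?_⟩
    rw [← hfl, ← hfl]
    -- The `L²` Cauchy property compares `F` with all later `G`, upgrading the ultrafilter limit to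
    -- a limit of the whole net.
    have hclose : ∀ᶠ G : 𝓔 in (U : Filter 𝓔), ‖f (F X) - f ((G : BoundedMap M) X)‖ ≤ ε / 2 := by
      filter_upwards [hU (tail_mem ⟨F₀, hF₀⟩)] with G hG
      rw [← map_sub]
      refine (h _ ?_ ?_).le
      · have h1 := F.le_of_opNorm_le (hn F hF𝓔) X
        have h2 := (G : BoundedMap M).le_of_opNorm_le (hn G G.2) X
        have := norm_sub_le (F X) ((G : BoundedMap M) X)
        linarith
      · have h1 := hF F hF𝓔 hle
        have h2 := hF G G.2 hG
        have e : toL2 hτ (F X - (G : BoundedMap M) X) =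
            toL2 hτ (F₀ X - (G : BoundedMap M) X) - toL2 hτ (F₀ X - F X) := by
          simp only [map_sub]; abel
        rw [e]
        refine (norm_sub_le _ _).trans ?_
        linarith
    have := le_of_tendsto ((tendsto_const_nhds (x := f (F X))).sub (hlim f hf X)).norm hclose
    linarith
  · ext1 X
    refine ext_normal fun l hl => ?_
    -- Since `l ∘ E` is normal, it may be evaluated along the net, where absorption makes it
    -- constantly `l (E X)`.
    have h1 := hlim _ ((hEadm.contractive τ hτ).comp_mem hτ hl) X
    refine tendsto_nhds_unique h1 (tendsto_const_nhds.congr fun F => ?_)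
    have h2 : (E * (F : BoundedMap M)) X = E X := by rw [habs F F.2]
    exact congrArg l h2.symm

end Net

end FiniteVN

/-! ### The main theorem. -/

open FiniteVN

theorem corollary2p7 {H : Type*} [NormedAddCommGroup H] [InnerProductSpace ℂ H] [CompleteSpace H]
    [TopologicalSpace.SeparableSpace H]
    (M : VonNeumannAlgebra H) (hM : FiniteVN.IsFinite M)
    (p : ℕ → ℝ) (c : ℝ) (hp : FiniteVN.IsRegularGauge p c)
    (S : Set (FiniteVN.Elt M)) (hne : S.Nonempty)
    (hcomm : ∀ T ∈ S, ∀ R ∈ S, T * R = R * T)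
    (hdom : ∀ T ∈ S, FiniteVN.IsDominatedBy T p) :
    ∃ ET : S → FiniteVN.BoundedMap M,
      (∀ T : S, FiniteVN.WeaklyAlmostConvergesTo (FiniteVN.conjSeq p (T : FiniteVN.Elt M)) (ET T) ∧
        IsIdempotentElem (ET T)) ∧
      (∀ T R : S, ET T * ET R = ET R * ET T) ∧
      ∃ E : FiniteVN.BoundedMap M,
        FiniteVN.NetConvergesWeaklyTo (Subsemigroup.closure (Set.range ET)) E ∧
        FiniteVN.IsCompletelyPositive E ∧
        FiniteVN.IsStable E ∧
        IsIdempotentElem E ∧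
        (∀ T ∈ S, ∀ X : FiniteVN.Elt M, E (star T * X * T) = ((c : ℂ) ^ 2) • E X) ∧
        (∀ A B : H →L[ℂ] H,
          (∀ T ∈ S, A * (T : H →L[ℂ] H) = (T : H →L[ℂ] H) * A) →
          (∀ T ∈ S, B * (T : H →L[ℂ] H) = (T : H →L[ℂ] H) * B) →
          ∀ X Y : FiniteVN.Elt M, (Y : H →L[ℂ] H) = star A * (X : H →L[ℂ] H) * B →
            (E Y : H →L[ℂ] H) = star A * (E X : H →L[ℂ] H) * B) := by
  -- One trace suffices to construct the limits; stability for every trace comes from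
  -- `IsAdmissible`, which quantifies over all of them.
  obtain ⟨τ, hτ⟩ := hM
  let U : Ultrafilter ℕ := Ultrafilter.of atTop
  have hU : (U : Filter ℕ) ≤ atTop := Ultrafilter.of_le _
  have hpos := hp.1.1
  have hlim : ∀ T : S, ∃ E : BoundedMap M, ‖E‖ ≤ 1 ∧ IsErgodicLimit p (T : Elt M) U E :=
    fun T => exists_map_limit U _ fun n =>
      ((isAdmissible_average (S := S) hpos T.2 (hdom T T.2) 0 n).contractive τ hτ).norm_le
  choose ET hET hlim using hlim
  have hadm : ∀ T : S, IsAdmissible S (ET T) := fun T =>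
    (hlim T).isAdmissible T.2 hpos (hdom T T.2) (hET T)
  have hidem : ∀ T : S, IsIdempotentElem (ET T) := fun T =>
    (hlim T).isIdempotentElem hU hp (hdom T T.2)
  have hcom : ∀ T R : S, ET T * ET R = ET R * ET T := fun T R =>
    commute_of_tendsto (hlim T) (hlim R)
      (fun n _ hl => ((isAdmissible_average (S := S) hpos T.2 (hdom T T.2) 0 n).contractive
        τ hτ).comp_mem hτ hl)
      (fun _ hl => ((hadm R).contractive τ hτ).comp_mem hτ hl)
      (fun _ _ => averageMap_commute
        (fun i j => conjSeq_commute (hcomm T T.2 R R.2) i j) _ _ _ _)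
  let 𝓔 := Subsemigroup.closure (Set.range ET)
  have h𝓔comm : ∀ F ∈ 𝓔, ∀ G ∈ 𝓔, F * G = G * F := fun F hF G hG => by
    induction hF, hG using Subsemigroup.closure_induction₂ with
    | mem x y hx hy =>
      obtain ⟨T, rfl⟩ := hx
      obtain ⟨R, rfl⟩ := hy
      exact hcom T R
    | mul_left x y z _ _ _ h₁ h₂ => exact (Commute.mul_left h₁ h₂ : Commute (x * y) z)
    | mul_right x y z _ _ _ h₁ h₂ => exact (Commute.mul_right h₁ h₂ : Commute z (x * y))
  have h𝓔adm : ∀ F ∈ 𝓔, IsAdmissible S F := fun F hF => by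
    induction hF using Subsemigroup.closure_induction with
    | mem x hx =>
      obtain ⟨T, rfl⟩ := hx
      exact hadm T
    | mul x y _ _ h₁ h₂ => exact h₁.mul h₂
  have h𝓔idem : ∀ F ∈ 𝓔, IsIdempotentElem F := fun F hF => by
    induction hF using Subsemigroup.closure_induction with
    | mem x hx =>
      obtain ⟨T, rfl⟩ := hx
      exact hidem T
    | mul x y hx hy h₁ h₂ => exact IsIdempotentElem.mul_of_commute (h𝓔comm x hx y hy) h₁ h₂
  have hmem : ∀ T : S, ET T ∈ 𝓔 := fun T => Subsemigroup.subset_closure ⟨T, rfl⟩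
  obtain ⟨T₀, hT₀⟩ := hne
  obtain ⟨E, hE, hconv, hEidem, habs⟩ :=
    exists_net_limit hτ h𝓔adm h𝓔idem ⟨_, hmem ⟨T₀, hT₀⟩⟩ h𝓔comm
  refine ⟨ET, fun T => ⟨(hlim T).weaklyAlmostConvergesTo hτ hU hp (hdom T T.2) (hET T),
    hidem T⟩, hcom, E, hconv, hE.completelyPositive,
    fun τ' hτ' => (hE.contractive τ' hτ').isStableFor hτ', hEidem, fun T hT X => ?_,
    hE.bimodule⟩
  -- Applying `E` to `E_T Θ = E_T` and absorbing `E_T` gives `E Θ = E`, which is (i) after clearing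
  -- `c²`.
  have h1 := (hlim ⟨T, hT⟩).apply_scaledConj hU hp (hdom T hT) X
  have h2 : ∀ Y, E (ET ⟨T, hT⟩ Y) = E Y := fun Y =>
    congrArg (fun F : BoundedMap M => F Y) (habs _ (hmem ⟨T, hT⟩))
  have h3 := congrArg E h1
  have hc : ((c : ℂ) ^ 2) ≠ 0 := pow_ne_zero _ (Complex.ofReal_ne_zero.2 hp.1.2.1.ne')
  rw [h2, h2, scaledConj_apply, map_smul, Complex.ofReal_inv, Complex.ofReal_pow,
    inv_smul_eq_iff₀ hc] at h3
  exact h3
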